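/- All groupoids are topological groupoids that are étale and locally compact with Hausdorff object space; their arrow spaces may be non-Hausdorff. Range and source maps are denoted $r,s$, and the anchor map of a left (right) action is denoted $r$ ($s$). A continuous map is proper if it is universally closed. \textbf{Setting.} Let $G$ and $H$ be groupoids and let $R\subseteq G^0$ be open and $G$-invariant. Let $X\colon G\leftarrow G$ be a groupoid correspondence, that is, a space with commuting left and right $G$-actions such that the right action is free and proper and $s\colon X\to G^0$ is a local homeomorphism. Assume that $X$ is regular on $R$: the map $r_*\colon X/G\to G^0$ induced by $r\colon X\to G^0$ restricts to a proper surjective map $r_*^{-1}(R)\to R$. An action of $(G,X,R)$ on a topological space $Y$ is a continuous $G$-action on $Y$ together with a continuous open map $X\times_{s,G^0,r}Y\to Y$, $(x,y)\mapsto x\cdot y$, such that (a) $r(x\cdot y)=r(x)$ and $g\cdot(x\cdot y)=(g\cdot x)\cdot y$ whenever $s(g)=r(x)$, $s(x)=r(y)$; (b) $x\cdot y=x'\cdot y'$ if and only if there is $g\in G$ with $x'=x\cdot g$ and $y=g\cdot y'$; (c) every $y\in Y$ with $r(y)\in R$ is of the form $x\cdot y'$; (d) for every compact $K\subseteq X/G$,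 the set of all $x\cdot y$ with $[x]\in K$ is closed in $Y$. A map $\varphi\colon Y_1\to Y_2$ between two such spaces is $(G,X)$-equivariant if it is compatible with the anchor maps, $\varphi(g\cdot y)=g\cdot\varphi(y)$ and $\varphi(x\cdot y)=x\cdot\varphi(y)$ whenever defined, and $\varphi^{-1}(X\cdot Y_2)=X\cdot Y_1$. Let $M$ be a groupoid model of $(G,X,R)$: a groupoid with a bijection, for every topological space $Y$, between $(G,X,R)$-actions and $M$-actions on $Y$, such that a continuous map between two spaces is $(G,X)$-equivariant if and only if it is equivariant for the associated $M$-actions. An actor $M\to H$ is an action of $M$ on the arrow space of $H$ that commutes with the right translation action of $H$; it is proper if the map $H^0\cong H/H\to M^0$ induced by its anchor map is proper. \textbf{Theorem.} Consider triples of continuous maps \[ \varrho\colon H^0\to G^0,\qquad \mu_G\colon G\times_{s,G^0,\varrho}H^0\to H,\qquad \mu_X\colon X\times_{s,G^0,\varrho}H^0\to H \] with $\mu_X$ open and \[ s(\mu_G(g,\omega))=\omega,\quad s(\mu_X(x,\omega))=\omega,\quad \varrho(r(\mu_G(g,\omega)))=r(g),\quad \varrho(r(\mu_X(x,\omega)))=r(x)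 \] for all $g\in G$, $x\in X$, $\omega\in H^0$ with $s(g)=\varrho(\omega)$, respectively $s(x)=\varrho(\omega)$. For $h\in H$ put $g\cdot h:=\mu_G(g,r(h))\,h$ if $s(g)=\varrho(r(h))$ and $x\cdot h:=\mu_X(x,r(h))\,h$ if $s(x)=\varrho(r(h))$. We say that the triple defines an actor $M\to H$ if $\varrho\circ r\colon H\to G^0$ and these two multiplication maps form the $(G,X,R)$-action on the arrow space of $H$ that corresponds to the underlying $M$-action of this actor. Such an actor is unique if it exists, and it exists if and only if the following conditions hold: 1. $g_1\cdot(g_2\cdot h)=(g_1g_2)\cdot h$, $g\cdot(x\cdot h)=(g\cdot x)\cdot h$, and $x\cdot(g\cdot h)=(x\cdot g)\cdot h$ for all composable triples with $g_1,g_2,g\in G$, $x\in X$, $h\in H$; 2. $1_{\varrho(\omega)}\cdot 1_\omega=1_\omega$ for all $\omega\in H^0$; 3. if $x_1\cdot y_1=x_2\cdot y_2$ with $x_i\in X$, $y_i\in H$, then there is $g\in G$ with $x_2=x_1\cdot g$ and $y_1=g\cdot y_2$; 4. the image of $r\circ\mu_X$ contains $\varrho^{-1}(R)$; 5. for every compact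 $K\subseteq X/G$, the set of all $r(x\cdot h)$ with $x\in X$, $h\in H$, $[x]\in K$, $s(x)=\varrho(r(h))$ is closed in $H^0$. Every actor $M\to H$ is defined by a unique such triple $(\varrho,\mu_G,\mu_X)$; hence actors $M\to H$ correspond bijectively to the triples that satisfy 1--5. The actor is proper if and only if $\varrho$ is proper. If $\varrho$ is proper, then condition 5 is redundant, that is, it follows from conditions 1--4. -/

import Mathlib

universe u

/-- The fibre product of two maps, with the subspace topology of the product. -/
abbrev FibreProduct {A B C : Type u} (f : A → C) (g : B → C) : Type u :=
  {p : A × B // f p.1 = g p.2}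

/-- An étale, locally compact (possibly non-Hausdorff) topological groupoid with Hausdorff object
space. The arrow space is locally compact because it is locally homeomorphic to the object space.
The product `mul g h` is defined when `s g = r h`. -/
structure EtaleGroupoid : Type (u + 1) where
  Obj : Type u
  Arr : Type u
  [topObj : TopologicalSpace Obj]
  [topArr : TopologicalSpace Arr]
  [t2Obj : T2Space Obj]
  [locallyCompactObj : LocallyCompactSpace Obj]
  r : Arr → Obj
  s : Arr → Obj
  unit : Obj → Arr
  inv : Arr → Arr
  mul : (g h : Arr) → s g = r h → Arr
  r_unit : ∀ a, r (unit a) = a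
  s_unit : ∀ a, s (unit a) = a
  r_inv : ∀ g, r (inv g) = s g
  s_inv : ∀ g, s (inv g) = r g
  r_mul : ∀ g h p, r (mul g h p) = r g
  s_mul : ∀ g h p, s (mul g h p) = s h
  mul_assoc : ∀ (g h k : Arr) (p : s g = r h) (q : s h = r k),
    mul (mul g h p) k ((s_mul g h p).trans q) = mul g (mul h k q) (p.trans (r_mul h k q).symm)
  unit_mul : ∀ g, mul (unit (r g)) g (s_unit (r g)) = g
  mul_unit : ∀ g, mul g (unit (s g)) (r_unit (s g)).symm = g
  inv_mul : ∀ g, mul (inv g) g (s_inv g) = unit (s g)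
  mul_inv : ∀ g, mul g (inv g) (r_inv g).symm = unit (r g)
  continuous_unit : Continuous unit
  continuous_inv : Continuous inv
  continuous_mul : Continuous fun p : FibreProduct s r => mul p.1.1 p.1.2 p.2
  isLocalHomeomorph_r : IsLocalHomeomorph r
  isLocalHomeomorph_s : IsLocalHomeomorph s

attribute [instance] EtaleGroupoid.topObj EtaleGroupoid.topArr EtaleGroupoid.t2Obj
  EtaleGroupoid.locallyCompactObj

/-- A subset of the object space is invariant if it contains the source of an arrow exactly when it
contains its range. -/
def EtaleGroupoid.IsInvariant (G : EtaleGroupoid.{u}) (R : Set G.Obj) : Prop :=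
  ∀ g : G.Arr, G.s g ∈ R ↔ G.r g ∈ R

/-- A (continuous) left action of a groupoid on a topological space, with anchor map `anchor`
(denoted `r` for left actions). The product `g · y` is defined when `s g = anchor y`. -/
@[ext]
structure LeftAction (G : EtaleGroupoid.{u}) (Y : Type u) [TopologicalSpace Y] : Type u where
  anchor : Y → G.Obj
  act : (g : G.Arr) → (y : Y) → G.s g = anchor y → Y
  continuous_anchor : Continuous anchor
  continuous_act : Continuous fun p : FibreProduct G.s anchor => act p.1.1 p.1.2 p.2
  anchor_act : ∀ g y p, anchor (act g y p) = G.r g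
  act_act : ∀ (g h : G.Arr) (y : Y) (p : G.s g = G.r h) (q : G.s h = anchor y),
    act g (act h y q) (p.trans (anchor_act h y q).symm) =
      act (G.mul g h p) y ((G.s_mul g h p).trans q)
  unit_act : ∀ y, act (G.unit (anchor y)) y (G.s_unit (anchor y)) = y

/-- A (continuous) right action of a groupoid on a topological space, with anchor map `anchor`
(denoted `s` for right actions). The product `x · g` is defined when `anchor x = r g`. -/
@[ext]
structure RightAction (G : EtaleGroupoid.{u}) (X : Type u) [TopologicalSpace X] : Type u where
  anchor : X → G.Obj
  act : (x : X) → (g : G.Arr) → anchor x = G.r g → X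
  continuous_anchor : Continuous anchor
  continuous_act : Continuous fun p : FibreProduct anchor G.r => act p.1.1 p.1.2 p.2
  anchor_act : ∀ x g p, anchor (act x g p) = G.s g
  act_act : ∀ (x : X) (g h : G.Arr) (p : anchor x = G.r g) (q : G.s g = G.r h),
    act (act x g p) h ((anchor_act x g p).trans q) =
      act x (G.mul g h q) (p.trans (G.r_mul g h q).symm)
  act_unit : ∀ x, act x (G.unit (anchor x)) (G.r_unit (anchor x)).symm = x

namespace RightAction

variable {G : EtaleGroupoid.{u}} {X : Type u} [TopologicalSpace X]

/-- Only unit arrows fix a point. -/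
def IsFree (A : RightAction G X) : Prop :=
  ∀ (x : X) (g : G.Arr) (p : A.anchor x = G.r g), A.act x g p = x → g = G.unit (A.anchor x)

/-- The map `(x, g) ↦ (x · g, x)` is proper (in the sense of Bourbaki). -/
def IsProper (A : RightAction G X) : Prop :=
  IsProperMap fun p : FibreProduct A.anchor G.r => (A.act p.1.1 p.1.2 p.2, p.1.1)

/-- Two points are equivalent if they lie in the same orbit. -/
def orbitRel (A : RightAction G X) : Setoid X where
  r x y := ∃ (g : G.Arr) (p : A.anchor x = G.r g), y = A.act x g p
  iseqv :=
    { refl := fun x => ⟨G.unit (A.anchor x), (G.r_unit _).symm, (A.act_unit x).symm⟩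
      symm := by
        rintro x y ⟨g, p, rfl⟩
        refine ⟨G.inv g, (A.anchor_act x g p).trans (G.r_inv g).symm, ?_⟩
        rw [A.act_act x g (G.inv g) p (G.r_inv g).symm]
        have h : G.mul g (G.inv g) (G.r_inv g).symm = G.unit (A.anchor x) := by
          rw [G.mul_inv, p]
        have key : ∀ (k : G.Arr) (q : A.anchor x = G.r k), k = G.unit (A.anchor x) →
            x = A.act x k q := by
          rintro k q rfl
          exact (A.act_unit x).symm
        exact key _ _ h
      trans := by
        rintro x y z ⟨g, p, rfl⟩ ⟨h, q, rfl⟩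
        have q' : G.s g = G.r h := (A.anchor_act x g p).symm.trans q
        exact ⟨G.mul g h q', p.trans (G.r_mul g h q').symm, A.act_act x g h p q'⟩ }

/-- The orbit space, with the quotient topology. -/
abbrev OrbitSpace (A : RightAction G X) : Type u := Quotient A.orbitRel

/-- The orbit space projection. -/
def proj (A : RightAction G X) (x : X) : A.OrbitSpace := Quotient.mk A.orbitRel x

end RightAction

/-- A groupoid correspondence `X : G ← H`: a space with commuting actions of `G` on the left and `H`
on the right, where the right action is free and proper and its anchor map is étale. The left anchor
map is `left.anchor` (written `r`) and the right anchor map is `right.anchor` (written `s`). -/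
structure Correspondence (G H : EtaleGroupoid.{u}) : Type (u + 1) where
  carrier : Type u
  [top : TopologicalSpace carrier]
  left : LeftAction G carrier
  right : RightAction H carrier
  r_right : ∀ x h p, left.anchor (right.act x h p) = left.anchor x
  s_left : ∀ g x p, right.anchor (left.act g x p) = right.anchor x
  commute : ∀ (g : G.Arr) (x : carrier) (h : H.Arr) (p : G.s g = left.anchor x)
    (q : right.anchor x = H.r h),
    right.act (left.act g x p) h ((s_left g x p).trans q) =
      left.act g (right.act x h q) (p.trans (r_right x h q).symm)
  free : right.IsFree
  proper : right.IsProper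
  etale : IsLocalHomeomorph right.anchor

attribute [instance] Correspondence.top

namespace Correspondence

variable {G H : EtaleGroupoid.{u}}

/-- The map `r_* : X / H → G⁰` induced by the left anchor map. -/
def rStar (C : Correspondence G H) : C.right.OrbitSpace → G.Obj :=
  Quotient.lift C.left.anchor (by
    rintro x y ⟨h, p, rfl⟩
    exact (C.r_right x h p).symm)

/-- The restriction `r_*⁻¹(R) → R` of `r_*` is proper and surjective. -/
def IsRegularOn (C : Correspondence G H) (R : Set G.Obj) : Prop :=
  IsProperMap (R.restrictPreimage C.rStar) ∧ Function.Surjective (R.restrictPreimage C.rStar)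

end Correspondence

/-- An action of `(G, X, R)` on a space `Y`: an action of the groupoid `G` together with a
continuous and open multiplication map `X ×_{s, G⁰, r} Y → Y`. -/
@[ext]
structure CorrAction {G : EtaleGroupoid.{u}} (C : Correspondence G G) (R : Set G.Obj)
    (Y : Type u) [TopologicalSpace Y] : Type u extends LeftAction G Y where
  xact : (x : C.carrier) → (y : Y) → C.right.anchor x = anchor y → Y
  continuous_xact :
    Continuous fun p : FibreProduct C.right.anchor anchor => xact p.1.1 p.1.2 p.2
  isOpenMap_xact :
    IsOpenMap fun p : FibreProduct C.right.anchor anchor => xact p.1.1 p.1.2 p.2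
  anchor_xact : ∀ x y p, anchor (xact x y p) = C.left.anchor x
  act_xact : ∀ (g : G.Arr) (x : C.carrier) (y : Y) (p : G.s g = C.left.anchor x)
    (q : C.right.anchor x = anchor y),
    act g (xact x y q) (p.trans (anchor_xact x y q).symm) =
      xact (C.left.act g x p) y ((C.s_left g x p).trans q)
  xact_eq_iff : ∀ (x x' : C.carrier) (y y' : Y) (p : C.right.anchor x = anchor y)
    (p' : C.right.anchor x' = anchor y'),
    xact x y p = xact x' y' p' ↔
      ∃ (g : G.Arr) (q : C.right.anchor x = G.r g) (q' : G.s g = anchor y'),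
        x' = C.right.act x g q ∧ y = act g y' q'
  covers : ∀ y : Y, anchor y ∈ R →
    ∃ (x : C.carrier) (y' : Y) (p : C.right.anchor x = anchor y'), xact x y' p = y
  closed : ∀ K : Set C.right.OrbitSpace, IsCompact K →
    IsClosed {z : Y | ∃ (x : C.carrier) (y : Y) (p : C.right.anchor x = anchor y),
      C.right.proj x ∈ K ∧ xact x y p = z}

/-- Equivariance of a map between two left actions of a groupoid. -/
def LeftAction.Equivariant {G : EtaleGroupoid.{u}} {Y₁ Y₂ : Type u} [TopologicalSpace Y₁]
    [TopologicalSpace Y₂] (a₁ : LeftAction G Y₁) (a₂ : LeftAction G Y₂) (f : Y₁ → Y₂) : Prop :=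
  ∃ h : ∀ y, a₂.anchor (f y) = a₁.anchor y,
    ∀ (g : G.Arr) (y : Y₁) (p : G.s g = a₁.anchor y),
      f (a₁.act g y p) = a₂.act g (f y) (p.trans (h y).symm)

namespace CorrAction

variable {G : EtaleGroupoid.{u}} {C : Correspondence G G} {R : Set G.Obj}
  {Y Y₁ Y₂ : Type u} [TopologicalSpace Y] [TopologicalSpace Y₁] [TopologicalSpace Y₂]

/-- The subset `X · Y` of `Y`, that is, the image of the multiplication map. -/
def xImage (a : CorrAction C R Y) : Set Y :=
  {z | ∃ (x : C.carrier) (y : Y) (p : C.right.anchor x = a.anchor y), a.xact x y p = z}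

/-- `(G, X)`-equivariance of a map between two actions. -/
def Equivariant (a₁ : CorrAction C R Y₁) (a₂ : CorrAction C R Y₂) (f : Y₁ → Y₂) : Prop :=
  (∃ h : ∀ y, a₂.anchor (f y) = a₁.anchor y,
    (∀ (g : G.Arr) (y : Y₁) (p : G.s g = a₁.anchor y),
      f (a₁.act g y p) = a₂.act g (f y) (p.trans (h y).symm)) ∧
    (∀ (x : C.carrier) (y : Y₁) (p : C.right.anchor x = a₁.anchor y),
      f (a₁.xact x y p) = a₂.xact x (f y) (p.trans (h y).symm))) ∧
  f ⁻¹' a₂.xImage = a₁.xImage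

end CorrAction

/-- A groupoid model of `(G, X, R)`: an étale groupoid `M` with a natural bijection, for all
topological spaces `Y`, between `(G, X, R)`-actions and `M`-actions on `Y`. -/
structure GroupoidModel {G : EtaleGroupoid.{u}} (C : Correspondence G G) (R : Set G.Obj) :
    Type (u + 1) where
  M : EtaleGroupoid.{u}
  equiv : (Y : Type u) → [TopologicalSpace Y] → CorrAction C R Y ≃ LeftAction M Y
  natural : ∀ (Y₁ Y₂ : Type u) [TopologicalSpace Y₁] [TopologicalSpace Y₂]
    (a₁ : CorrAction C R Y₁) (a₂ : CorrAction C R Y₂) (f : Y₁ → Y₂), Continuous f →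
    (CorrAction.Equivariant a₁ a₂ f ↔ LeftAction.Equivariant (equiv Y₁ a₁) (equiv Y₂ a₂) f)

/-- An actor `M → H`: an action of `M` on the arrow space of `H` that commutes with the right
translation action of `H`. -/
@[ext]
structure Actor (M H : EtaleGroupoid.{u}) : Type u extends LeftAction M H.Arr where
  s_act : ∀ m h p, H.s (act m h p) = H.s h
  anchor_mul : ∀ h k p, anchor (H.mul h k p) = anchor h
  act_mul : ∀ (m : M.Arr) (h k : H.Arr) (p : M.s m = anchor h) (q : H.s h = H.r k),
    H.mul (act m h p) k ((s_act m h p).trans q) =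
      act m (H.mul h k q) (p.trans (anchor_mul h k q).symm)

namespace Actor

variable {M H : EtaleGroupoid.{u}}

/-- The map `H⁰ ≅ H / H → M⁰` induced by the anchor map of the action. -/
def objMap (A : Actor M H) (ω : H.Obj) : M.Obj := A.anchor (H.unit ω)

theorem objMap_r (A : Actor M H) (h : H.Arr) : A.objMap (H.r h) = A.anchor h := by
  have := A.anchor_mul h (H.inv h) (H.r_inv h).symm
  rw [H.mul_inv] at this
  exact this

/-- An actor is proper if the induced map `H⁰ → M⁰` is proper. -/
def IsProper (A : Actor M H) : Prop := IsProperMap A.objMap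

end Actor

/-- A triple of continuous maps `ϱ : H⁰ → G⁰`, `μ_G : G ×_{s, G⁰, ϱ} H⁰ → H` and
`μ_X : X ×_{s, G⁰, ϱ} H⁰ → H` with `μ_X` open, and with the given sources and ranges. -/
structure ActorData {G : EtaleGroupoid.{u}} (C : Correspondence G G) (H : EtaleGroupoid.{u}) :
    Type u where
  rho : H.Obj → G.Obj
  muG : (g : G.Arr) → (ω : H.Obj) → G.s g = rho ω → H.Arr
  muX : (x : C.carrier) → (ω : H.Obj) → C.right.anchor x = rho ω → H.Arr
  continuous_rho : Continuous rho
  continuous_muG : Continuous fun p : FibreProduct G.s rho => muG p.1.1 p.1.2 p.2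
  continuous_muX : Continuous fun p : FibreProduct C.right.anchor rho => muX p.1.1 p.1.2 p.2
  isOpenMap_muX : IsOpenMap fun p : FibreProduct C.right.anchor rho => muX p.1.1 p.1.2 p.2
  s_muG : ∀ g ω p, H.s (muG g ω p) = ω
  s_muX : ∀ x ω p, H.s (muX x ω p) = ω
  rho_r_muG : ∀ g ω p, rho (H.r (muG g ω p)) = G.r g
  rho_r_muX : ∀ x ω p, rho (H.r (muX x ω p)) = C.left.anchor x

namespace ActorData

variable {G H : EtaleGroupoid.{u}} {C : Correspondence G G}

/-- `g · h = μ_G(g, r(h)) h`, defined when `s(g) = ϱ(r(h))`. -/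
def gmul (t : ActorData C H) (g : G.Arr) (h : H.Arr) (p : G.s g = t.rho (H.r h)) : H.Arr :=
  H.mul (t.muG g (H.r h) p) h (t.s_muG g (H.r h) p)

/-- `x · h = μ_X(x, r(h)) h`, defined when `s(x) = ϱ(r(h))`. -/
def xmul (t : ActorData C H) (x : C.carrier) (h : H.Arr)
    (p : C.right.anchor x = t.rho (H.r h)) : H.Arr :=
  H.mul (t.muX x (H.r h) p) h (t.s_muX x (H.r h) p)

theorem rho_r_gmul (t : ActorData C H) (g : G.Arr) (h : H.Arr) (p : G.s g = t.rho (H.r h)) :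
    t.rho (H.r (t.gmul g h p)) = G.r g := by
  rw [gmul, H.r_mul, t.rho_r_muG]

theorem rho_r_xmul (t : ActorData C H) (x : C.carrier) (h : H.Arr)
    (p : C.right.anchor x = t.rho (H.r h)) : t.rho (H.r (t.xmul x h p)) = C.left.anchor x := by
  rw [xmul, H.r_mul, t.rho_r_muX]

/-- The three associativity laws. -/
def Associative (t : ActorData C H) : Prop :=
  (∀ (g₁ g₂ : G.Arr) (h : H.Arr) (p : G.s g₁ = G.r g₂) (q : G.s g₂ = t.rho (H.r h)),
    t.gmul g₁ (t.gmul g₂ h q) (p.trans (t.rho_r_gmul g₂ h q).symm) =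
      t.gmul (G.mul g₁ g₂ p) h ((G.s_mul g₁ g₂ p).trans q)) ∧
  (∀ (g : G.Arr) (x : C.carrier) (h : H.Arr) (p : G.s g = C.left.anchor x)
    (q : C.right.anchor x = t.rho (H.r h)),
    t.gmul g (t.xmul x h q) (p.trans (t.rho_r_xmul x h q).symm) =
      t.xmul (C.left.act g x p) h ((C.s_left g x p).trans q)) ∧
  (∀ (x : C.carrier) (g : G.Arr) (h : H.Arr) (p : C.right.anchor x = G.r g)
    (q : G.s g = t.rho (H.r h)),
    t.xmul x (t.gmul g h q) (p.trans (t.rho_r_gmul g h q).symm) =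
      t.xmul (C.right.act x g p) h ((C.right.anchor_act x g p).trans q))

/-- `1_{ϱ(ω)} · ω = ω`, where objects of `H` are identified with their unit arrows. -/
def Unital (t : ActorData C H) : Prop :=
  ∀ ω : H.Obj, t.gmul (G.unit (t.rho ω)) (H.unit ω)
    ((G.s_unit (t.rho ω)).trans (congrArg t.rho (H.r_unit ω).symm)) = H.unit ω

/-- If `x₁ · y₁ = x₂ · y₂`, then `x₂ = x₁ · g` and `y₁ = g · y₂` for some `g`. -/
def IdentifiesOrbits (t : ActorData C H) : Prop :=
  ∀ (x₁ x₂ : C.carrier) (y₁ y₂ : H.Arr) (p₁ : C.right.anchor x₁ = t.rho (H.r y₁))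
    (p₂ : C.right.anchor x₂ = t.rho (H.r y₂)), t.xmul x₁ y₁ p₁ = t.xmul x₂ y₂ p₂ →
    ∃ (g : G.Arr) (q₁ : C.right.anchor x₁ = G.r g) (q₂ : G.s g = t.rho (H.r y₂)),
      x₂ = C.right.act x₁ g q₁ ∧ y₁ = t.gmul g y₂ q₂

/-- The image of `r ∘ μ_X` contains `ϱ⁻¹(R)`. -/
def Covers (t : ActorData C H) (R : Set G.Obj) : Prop :=
  t.rho ⁻¹' R ⊆ {η : H.Obj | ∃ (x : C.carrier) (ω : H.Obj) (p : C.right.anchor x = t.rho ω),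
    H.r (t.muX x ω p) = η}

/-- For compact `K ⊆ X / G`, the set of all `r(x · h)` with `[x] ∈ K` is closed in `H⁰`. -/
def HasClosedImages (t : ActorData C H) : Prop :=
  ∀ K : Set C.right.OrbitSpace, IsCompact K →
    IsClosed {η : H.Obj | ∃ (x : C.carrier) (h : H.Arr) (p : C.right.anchor x = t.rho (H.r h)),
      C.right.proj x ∈ K ∧ H.r (t.xmul x h p) = η}

/-- The actor `A : M → H` is the one defined by the triple `t`: the `(G, X, R)`-action on the arrow
space of `H` that corresponds to the underlying `M`-action of `A` has the anchor map `ϱ ∘ r` and the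
multiplication maps `g · h = μ_G(g, r(h)) h` and `x · h = μ_X(x, r(h)) h`. -/
def Defines {R : Set G.Obj} (t : ActorData C H) (𝓜 : GroupoidModel C R)
    (A : Actor 𝓜.M H) : Prop :=
  let a : CorrAction C R H.Arr := (𝓜.equiv H.Arr).symm A.toLeftAction
  ∃ e : ∀ h, a.anchor h = t.rho (H.r h),
    (∀ (g : G.Arr) (h : H.Arr) (p : G.s g = a.anchor h),
      a.act g h p = t.gmul g h (p.trans (e h))) ∧
    (∀ (x : C.carrier) (h : H.Arr) (p : C.right.anchor x = a.anchor h),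
      a.xact x h p = t.xmul x h (p.trans (e h)))

end ActorData

/-! An action of `(G, X, R)` on the arrow space of `H` that commutes with right translations is
determined by its values at units: `h = 1_{r(h)} h` forces `g · h = (g · 1_{r(h)}) h`, and likewise
for `x`. So such actions are triples `(ϱ, μ_G, μ_X)`. Right invariance also turns the axioms on `H`
into conditions on `H⁰`: a point `z` with `r(z) = r(x · h)` is itself `x · (h (x · h)⁻¹ z)`, so the
relevant subsets of `H` are preimages under `r` of subsets of `H⁰`. Openness of the multiplication
is checked after composing with the étale map `s`.

It remains to see that the bijection of a groupoid model matches the right invariant actions on both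
sides (`GroupoidModel.isRightInvariant_iff`). The model only knows equivariant maps, so right
invariance is rephrased through them: for suitable actions on the source fibres of `H`, made
discrete, the inclusion into `H` and the right translation by any `k` are equivariant. Naturality
carries this statement across.

For properness, `M⁰` is terminal among actions, and its `(G, X, R)`-action has an anchor map `M⁰ →
G⁰` with `ϱ` equal to the composite `H⁰ → M⁰ → G⁰`. If this anchor map is proper, then `H⁰ → M⁰` is
proper if and only if `ϱ` is, because `M⁰` is Hausdorff. That it is proper
(`GroupoidModel.isProperMap_objCorrAction_anchor`) is deduced from the universal property alone. Any
action on `Y` extends to the space of ultrafilters on `Y` whose image in `G⁰` converges, topologised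
so that principal ultrafilters are isolated and each ultrafilter is the limit of its own points.
Properness of the right action, regularity on `R` and compactness of the sets `K` verify the axioms
there. For `Y = M⁰`, the map from this space to the terminal object `M⁰` is the identity on
principal ultrafilters; its continuity then gives every such ultrafilter a limit in `M⁰`.

Finally, if `ϱ` is proper, condition 5 holds by a limit argument: in `x_i · h_i` with `[x_i] ∈ K`
the `x_i` may be chosen convergent, and then properness of `ϱ` makes the `r(h_i)` converge. -/

open Filter Topology

/-! ### Open and étale maps under base change. -/

section FibreProducts

variable {A B C : Type u} [TopologicalSpace A] [TopologicalSpace B] [TopologicalSpace C]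

theorem IsLocalHomeomorph.exists_injOn {f : A → C} (hf : IsLocalHomeomorph f) (a : A) :
    ∃ V ∈ 𝓝 a, Set.InjOn f V := by
  obtain ⟨e, he, rfl⟩ := hf a
  exact ⟨e.source, e.open_source.mem_nhds he, e.injOn⟩

theorem FibreProduct.isOpenMap_snd {f : A → C} {g : B → C} (hf : IsOpenMap f)
    (hg : Continuous g) : IsOpenMap fun p : FibreProduct f g => p.1.2 := by
  rw [isOpenMap_iff_nhds_le]
  rintro ⟨⟨a, b⟩, h⟩ S hS
  rw [mem_map, nhds_subtype_eq_comap, mem_comap] at hS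
  obtain ⟨T, hT, hTS⟩ := hS
  obtain ⟨V, hV, W, hW, hVW⟩ := mem_nhds_prod_iff.1 hT
  have hfV : f '' V ∈ 𝓝 (g b) := by
    have h' : f a = g b := h
    rw [← h']
    exact hf.image_mem_nhds hV
  filter_upwards [hW, hg.continuousAt hfV] with b' hb' hb''
  obtain ⟨a', ha', e⟩ := hb''
  exact hTS (a := ⟨(a', b'), e⟩) (hVW ⟨ha', hb'⟩)

theorem FibreProduct.isOpenMap_fst {f : A → C} {g : B → C} (hf : Continuous f)
    (hg : IsOpenMap g) : IsOpenMap fun p : FibreProduct f g => p.1.1 := by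
  have h := FibreProduct.isOpenMap_snd hg hf
  have hc : IsOpenMap fun p : FibreProduct f g => (⟨(p.1.2, p.1.1), p.2.symm⟩ : FibreProduct g f) :=
    ((Homeomorph.prodComm A B).subtype fun _ => eq_comm).isOpenMap
  exact h.comp hc

/-- Near `f a` the map `s` is injective, so an open image under `s ∘ f` pulls back to a
neighbourhood inside the image of `f`. This gives openness of the multiplications into the arrow
space of `H`, where only sources need to be examined. -/
theorem IsLocalHomeomorph.isOpenMap_of_comp {f : A → B} {s : B → C} (hs : IsLocalHomeomorph s)
    (hf : Continuous f) (hsf : IsOpenMap fun a => s (f a)) : IsOpenMap f := by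
  rw [isOpenMap_iff_nhds_le]
  intro a S hS
  obtain ⟨V, hV, hinj⟩ := hs.exists_injOn (f a)
  have h1 : s '' (V ∩ f '' (f ⁻¹' V ∩ f ⁻¹' S)) ∈ 𝓝 (s (f a)) := by
    refine mem_of_superset (hsf.image_mem_nhds (inter_mem (hf.continuousAt hV) hS)) ?_
    rintro _ ⟨a', ha', rfl⟩
    exact ⟨f a', ⟨ha'.1, a', ha', rfl⟩, rfl⟩
  filter_upwards [hV, hs.continuous.continuousAt h1] with b hb hb'
  obtain ⟨b', ⟨hb'V, a', ha', rfl⟩, e⟩ := hb'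
  rw [← hinj hb'V hb e]
  exact ha'.2

theorem FibreProduct.discreteTopology [DiscreteTopology B] {f : A → C} (hf : IsLocalHomeomorph f)
    (g : B → C) : DiscreteTopology (FibreProduct f g) := by
  refine discreteTopology_iff_singleton_mem_nhds.2 ?_
  rintro ⟨⟨a, b⟩, h⟩
  obtain ⟨V, hV, hinj⟩ := hf.exists_injOn a
  rw [nhds_subtype_eq_comap, mem_comap]
  refine ⟨V ×ˢ {b}, prod_mem_nhds hV (by simp), ?_⟩
  rintro ⟨⟨a', b'⟩, h'⟩ ⟨ha', rfl : b' = b⟩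
  have : a' = a := hinj ha' (mem_of_mem_nhds hV) (h'.trans h.symm)
  subst this
  rfl

end FibreProducts

/-! ### Algebra of groupoids and actions; orbit spaces. -/

namespace EtaleGroupoid

variable (G : EtaleGroupoid.{u})

theorem mul_congr {g g' h h' : G.Arr} (hg : g = g') (hh : h = h') (p : G.s g = G.r h)
    (p' : G.s g' = G.r h') : G.mul g h p = G.mul g' h' p' := by
  subst hg hh; rfl

theorem mul_inv_cancel_right (g h : G.Arr) (p : G.s g = G.r h) :
    G.mul (G.mul g h p) (G.inv h) ((G.s_mul g h p).trans (G.r_inv h).symm) = g := by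
  rw [G.mul_assoc g h (G.inv h) p (G.r_inv h).symm]
  rw [G.mul_congr rfl (G.mul_inv h) _ (p.trans (G.r_unit _).symm),
    G.mul_congr rfl (congrArg G.unit p.symm) _ (G.r_unit _).symm, G.mul_unit]

theorem mul_inv_mul (g h : G.Arr) (p : G.r g = G.r h) :
    G.mul g (G.mul (G.inv g) h ((G.s_inv g).trans p))
      ((G.r_inv g).symm.trans (G.r_mul _ _ _).symm) = h := by
  rw [← G.mul_assoc g (G.inv g) h (G.r_inv g).symm]
  rw [G.mul_congr (G.mul_inv g) rfl _ ((G.s_unit _).trans p),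
    G.mul_congr (congrArg G.unit p) rfl _ (G.s_unit _), G.unit_mul]

end EtaleGroupoid

namespace LeftAction

variable {G : EtaleGroupoid.{u}} {Y : Type u} [TopologicalSpace Y] (L : LeftAction G Y)

theorem act_congr {g g' : G.Arr} {y y' : Y} (hg : g = g') (hy : y = y') (p : G.s g = L.anchor y)
    (p' : G.s g' = L.anchor y') : L.act g y p = L.act g' y' p' := by
  subst hg hy; rfl

theorem act_inv_act (g : G.Arr) (y : Y) (p : G.r g = L.anchor y) :
    L.act g (L.act (G.inv g) y ((G.s_inv g).trans p))
      ((G.r_inv g).symm.trans (L.anchor_act _ _ _).symm) = y := by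
  rw [L.act_act g (G.inv g) y (G.r_inv g).symm]
  rw [L.act_congr (G.mul_inv g) rfl _ ((G.s_unit _).trans p),
    L.act_congr (congrArg G.unit p) rfl _ (G.s_unit _), L.unit_act]

end LeftAction

namespace RightAction

variable {G : EtaleGroupoid.{u}} {X : Type u} [TopologicalSpace X] (A : RightAction G X)

theorem proj_eq_proj_iff {x y : X} :
    A.proj x = A.proj y ↔ ∃ (g : G.Arr) (p : A.anchor x = G.r g), y = A.act x g p :=
  Quotient.eq (r := A.orbitRel)

theorem proj_act (x : X) (g : G.Arr) (p : A.anchor x = G.r g) : A.proj (A.act x g p) = A.proj x :=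
  (A.proj_eq_proj_iff.2 ⟨g, p, rfl⟩).symm

theorem isOpenMap_proj : IsOpenMap A.proj := by
  intro V hV
  refine isOpen_coinduced.2 ?_
  have h : IsOpenMap fun p : FibreProduct A.anchor G.r => p.1.1 :=
    FibreProduct.isOpenMap_fst A.continuous_anchor G.isLocalHomeomorph_r.isOpenMap
  convert h _ (hV.preimage A.continuous_act) using 1
  ext x
  constructor
  · rintro ⟨y, hy, e⟩
    obtain ⟨g, p, rfl⟩ := A.proj_eq_proj_iff.1 e.symm
    exact ⟨⟨(x, g), p⟩, hy, rfl⟩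
  · rintro ⟨⟨⟨x', g⟩, p⟩, hy, rfl⟩
    exact ⟨_, hy, A.proj_act _ _ _⟩

/-- If the orbits of `q` converge along an ultrafilter, then `q` itself converges along another
ultrafilter with the same image under a map `m` that is constant along the orbits. -/
theorem exists_ultrafilter_tendsto {E Z : Type u} (q : E → X) (m : E → Z)
    (hsat : ∀ e x, A.proj x = A.proj (q e) → ∃ e', q e' = x ∧ m e' = m e)
    (𝒲 : Ultrafilter E) (x : X) (h : Tendsto (fun e => A.proj (q e)) 𝒲 (𝓝 (A.proj x))) :
    ∃ 𝒱 : Ultrafilter E, Tendsto q 𝒱 (𝓝 x) ∧ 𝒱.map m = 𝒲.map m := by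
  -- Openness of the orbit projection makes the two conditions compatible: near `x` there are points
  -- in the orbits of almost all `q e`, and `hsat` moves `e` along its orbit without changing `m e`.
  have hne : NeBot (comap q (𝓝 x) ⊓ comap m (𝒲.map m)) := by
    rw [← forall_mem_nonempty_iff_neBot]
    rintro S hS
    obtain ⟨T, ⟨V, hV, hVT⟩, T', ⟨W, hW, hWT'⟩, rfl⟩ := mem_inf_iff.1 hS
    have h1 : {e | A.proj (q e) ∈ A.proj '' V} ∈ 𝒲 := h (A.isOpenMap_proj.image_mem_nhds hV)
    obtain ⟨e, ⟨x', hx', e1⟩, he⟩ := 𝒲.nonempty_of_mem (inter_mem h1 hW)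
    obtain ⟨e', rfl, e2⟩ := hsat e x' e1
    refine ⟨e', hVT hx', hWT' ?_⟩
    change m e' ∈ W
    rw [e2]
    exact he
  obtain ⟨𝒱, h𝒱⟩ := Ultrafilter.exists_le (comap q (𝓝 x) ⊓ comap m (𝒲.map m))
  exact ⟨𝒱, tendsto_iff_comap.2 (h𝒱.trans inf_le_left),
    Ultrafilter.eq_of_le (map_le_iff_le_comap.2 (h𝒱.trans inf_le_right))⟩

end RightAction

namespace CorrAction

variable {G : EtaleGroupoid.{u}} {C : Correspondence G G} {R : Set G.Obj}
  {Y : Type u} [TopologicalSpace Y] (a : CorrAction C R Y)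

theorem xact_congr {x x' : C.carrier} {y y' : Y} (hx : x = x') (hy : y = y')
    (p : C.right.anchor x = a.anchor y) (p' : C.right.anchor x' = a.anchor y') :
    a.xact x y p = a.xact x' y' p' := by
  subst hx hy; rfl

theorem xact_act (x : C.carrier) (g : G.Arr) (y : Y) (p : C.right.anchor x = G.r g)
    (q : G.s g = a.anchor y) :
    a.xact x (a.act g y q) (p.trans (a.anchor_act g y q).symm) =
      a.xact (C.right.act x g p) y ((C.right.anchor_act x g p).trans q) :=
  (a.xact_eq_iff _ _ _ _ _ _).2 ⟨g, p, q, rfl, rfl⟩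

end CorrAction

/-! ### The space of end points and the extension of maps to it. -/

/-- An ultrafilter on the total space of a map `π : Z → B`, together with a limit of its image. -/
@[ext]
structure EndPoint {Z B : Type u} [TopologicalSpace B] (π : Z → B) : Type u where
  ult : Ultrafilter Z
  base : B
  tendsto : Tendsto π ult (𝓝 base)

namespace EndPoint

variable {A B B' Z Z' I : Type u} [TopologicalSpace A] [TopologicalSpace B] [TopologicalSpace B']
  {π : Z → B} {π' : Z' → B'} {s : A → B} {r : A → B'}

/-- The end point given by a principal ultrafilter. -/
def principal (π : Z → B) (z : Z) : EndPoint π :=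
  ⟨pure z, π z, tendsto_pure_nhds π z⟩

/-- Principal ultrafilters are isolated points, and the principal ultrafilters of the points of `Z`
converge to an end point along its ultrafilter. -/
instance : TopologicalSpace (EndPoint π) :=
  .mkOfNhds fun y => pure y ⊔ map (principal π) y.ult

/-- The prescribed filters are neighbourhood filters because principal points are isolated: a set in
the filter of `y` is a neighbourhood of each principal point it contains. -/
theorem nhds_eq (y : EndPoint π) : 𝓝 y = pure y ⊔ map (principal π) y.ult := by
  refine TopologicalSpace.nhds_mkOfNhds _ y (fun _ => le_sup_left) ?_
  rintro y S ⟨hS, hS'⟩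
  refine ⟨⟨hS, hS'⟩, ?_⟩
  refine eventually_map.2 ?_
  filter_upwards [mem_map.1 hS'] with z hz
  exact ⟨hz, Ultrafilter.mem_pure.2 hz⟩

theorem tendsto_principal (y : EndPoint π) : Tendsto (principal π) y.ult (𝓝 y) := by
  rw [nhds_eq]
  exact le_sup_right

theorem continuous_base : Continuous (base : EndPoint π → B) := by
  refine continuous_iff_continuousAt.2 fun y => ?_
  rw [ContinuousAt, nhds_eq]
  exact tendsto_sup.2 ⟨tendsto_pure_nhds _ _, tendsto_map'_iff.2 y.tendsto⟩

theorem ext_ult [T2Space B] {y y' : EndPoint π} (h : y.ult = y'.ult) : y = y' :=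
  EndPoint.ext h (tendsto_nhds_unique y.tendsto (h ▸ y'.tendsto))

/-- Openness of `s` makes the filter on the right proper, and local injectivity of `s` makes it an
ultrafilter: near `a`, a point of the fibre product is determined by its component in `Z`. -/
theorem exists_lift (hs : IsLocalHomeomorph s) (p : FibreProduct s (base : EndPoint π → B)) :
    ∃ 𝒲 : Ultrafilter (FibreProduct s π),
      (𝒲 : Filter (FibreProduct s π)) =
        comap (fun e => e.1.1) (𝓝 p.1.1) ⊓ comap (fun e => e.1.2) p.1.2.ult := by
  obtain ⟨⟨a, y⟩, h⟩ := p
  change s a = y.base at h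
  set F : Filter (FibreProduct s π) :=
    comap (fun e => e.1.1) (𝓝 a) ⊓ comap (fun e => e.1.2) y.ult with hF
  have hne : NeBot F := by
    rw [← forall_mem_nonempty_iff_neBot]
    rintro S hS
    obtain ⟨T, ⟨V, hV, hVT⟩, T', ⟨W, hW, hWT'⟩, rfl⟩ := mem_inf_iff.1 hS
    have h1 : π ⁻¹' (s '' V) ∈ y.ult := y.tendsto (h ▸ hs.isOpenMap.image_mem_nhds hV)
    obtain ⟨z, ⟨a', ha', e⟩, hz⟩ := y.ult.nonempty_of_mem (inter_mem h1 hW)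
    exact ⟨⟨(a', z), e⟩, hVT ha', hWT' hz⟩
  obtain ⟨𝒲, h𝒲⟩ := Ultrafilter.exists_le F
  refine ⟨𝒲, le_antisymm h𝒲 ?_⟩
  have hmap : 𝒲.map (fun e => e.1.2) = y.ult :=
    Ultrafilter.eq_of_le (map_le_iff_le_comap.2 (h𝒲.trans inf_le_right))
  intro S hS
  obtain ⟨V, hV, hinj⟩ := hs.exists_injOn a
  have hVF : {e : FibreProduct s π | e.1.1 ∈ V} ∈ F := mem_inf_of_left (preimage_mem_comap hV)
  have hSV : (fun e : FibreProduct s π => e.1.2) '' (S ∩ {e | e.1.1 ∈ V}) ∈ y.ult := by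
    rw [← hmap]
    exact mem_of_superset (x := S ∩ {e | e.1.1 ∈ V}) (inter_mem hS (h𝒲 hVF))
      (Set.subset_preimage_image _ _)
  refine mem_of_superset (inter_mem hVF
    (mem_inf_of_right (preimage_mem_comap hSV))) ?_
  rintro ⟨⟨a₁, z₁⟩, h₁⟩ ⟨ha₁ : a₁ ∈ V, ⟨⟨a₂, z₂⟩, h₂⟩, ⟨hS₂, ha₂ : a₂ ∈ V⟩, e : z₂ = z₁⟩
  subst e
  have : a₁ = a₂ := hinj ha₁ ha₂ (h₁.trans h₂.symm)
  subst this
  exact hS₂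

/-- The ultrafilter on the fibre product `A ×_B Z` that belongs to a point of `A` and an end
point over it, for an étale map `A → B`. -/
noncomputable def lift (hs : IsLocalHomeomorph s) (p : FibreProduct s (base : EndPoint π → B)) :
    Ultrafilter (FibreProduct s π) :=
  (exists_lift hs p).choose

theorem lift_eq (hs : IsLocalHomeomorph s) (p : FibreProduct s (base : EndPoint π → B)) :
    (lift hs p : Filter (FibreProduct s π)) =
      comap (fun e => e.1.1) (𝓝 p.1.1) ⊓ comap (fun e => e.1.2) p.1.2.ult :=
  (exists_lift hs p).choose_spec

theorem tendsto_lift (hs : IsLocalHomeomorph s) (p : FibreProduct s (base : EndPoint π → B)) :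
    Tendsto (fun e : FibreProduct s π => e.1.1) (lift hs p) (𝓝 p.1.1) :=
  tendsto_iff_comap.2 ((lift_eq hs p).le.trans inf_le_left)

theorem map_lift (hs : IsLocalHomeomorph s) (p : FibreProduct s (base : EndPoint π → B)) :
    (lift hs p).map (fun e : FibreProduct s π => e.1.2) = p.1.2.ult :=
  Ultrafilter.eq_of_le (map_le_iff_le_comap.2 ((lift_eq hs p).le.trans inf_le_right))

theorem map_eq_lift (hs : IsLocalHomeomorph s) (p : FibreProduct s (base : EndPoint π → B))
    (𝒲 : Ultrafilter I) (f : I → A) (k : I → Z) (h : ∀ i, s (f i) = π (k i))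
    (hf : Tendsto f 𝒲 (𝓝 p.1.1)) (hk : 𝒲.map k = p.1.2.ult) :
    𝒲.map (fun i => (⟨(f i, k i), h i⟩ : FibreProduct s π)) = lift hs p := by
  refine Ultrafilter.eq_of_le ?_
  rw [lift_eq hs p]
  refine le_inf (map_le_iff_le_comap.1 ?_) (map_le_iff_le_comap.1 ?_)
  · rw [Ultrafilter.coe_map, map_map]
    exact hf
  · rw [← hk]
    exact le_rfl

/-- The point of `A ×_B EndPoint π` over a point of `A ×_B Z`. -/
def liftPrincipal (e : FibreProduct s π) : FibreProduct s (base : EndPoint π → B) :=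
  ⟨(e.1.1, principal π e.1.2), e.2⟩

/-- Fibre products with an étale map inherit the shape of the neighbourhood filters: since `s` is
injective near `p.1.1`, the only nearby points are `p` itself and points over principal
ultrafilters. -/
theorem nhds_fibreProduct (hs : IsLocalHomeomorph s)
    (p : FibreProduct s (base : EndPoint π → B)) :
    𝓝 p = pure p ⊔ map liftPrincipal (lift hs p) := by
  apply le_antisymm
  · obtain ⟨⟨a, y⟩, h⟩ := p
    rintro S ⟨hpS, hS⟩
    change liftPrincipal ⁻¹' S ∈ (lift hs ⟨(a, y), h⟩ : Filter (FibreProduct s π)) at hS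
    rw [lift_eq] at hS
    obtain ⟨T, ⟨V, hV, hVT⟩, T', ⟨W, hW, hWT'⟩, hTT'⟩ := mem_inf_iff.1 hS
    obtain ⟨V', hV', hinj⟩ := hs.exists_injOn a
    have hN : insert y (principal π '' W) ∈ 𝓝 y := by
      rw [nhds_eq]
      refine ⟨Set.mem_insert _ _, ?_⟩
      refine mem_map.2 (mem_of_superset hW fun z hz => ?_)
      exact Set.mem_insert_of_mem _ ⟨z, hz, rfl⟩
    rw [nhds_subtype_eq_comap, mem_comap]
    refine ⟨_, prod_mem_nhds (inter_mem hV hV') hN, ?_⟩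
    rintro ⟨⟨a', y'⟩, h'⟩ ⟨ha', hy' | ⟨z, hz, hy'⟩⟩
    · change y' = y at hy'
      subst hy'
      have : a' = a := hinj ha'.2 (mem_of_mem_nhds hV') (h'.trans h.symm)
      subst this
      exact hpS
    · change principal π z = y' at hy'
      subst hy'
      have : (⟨(a', z), h'⟩ : FibreProduct s π) ∈ T ∩ T' := ⟨hVT ha'.1, hWT' hz⟩
      rw [← hTT'] at this
      exact this
  · refine sup_le (pure_le_nhds p) ?_
    rw [nhds_subtype_eq_comap, ← map_le_iff_le_comap, map_map]
    obtain ⟨⟨a, y⟩, h⟩ := p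
    rw [nhds_prod_eq]
    refine Tendsto.prodMk (tendsto_lift hs _) ?_
    have h2 : Tendsto (fun e : FibreProduct s π => e.1.2) (lift hs ⟨(a, y), h⟩) y.ult :=
      (congrArg Ultrafilter.toFilter (map_lift hs _)).le
    exact (tendsto_principal y).comp h2

/-- The extension of a map `A ×_B Z → Z'` to end points. -/
noncomputable def push (hs : IsLocalHomeomorph s) (hr : Continuous r) (m : FibreProduct s π → Z')
    (hm : ∀ e, π' (m e) = r e.1.1) (p : FibreProduct s (base : EndPoint π → B)) : EndPoint π' where
  ult := (lift hs p).map m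
  base := r p.1.1
  tendsto := by
    refine tendsto_map'_iff.2 ?_
    have : π' ∘ m = fun e => r e.1.1 := funext hm
    rw [this]
    exact (hr.tendsto _).comp (tendsto_lift hs p)

section Push

variable (hs : IsLocalHomeomorph s) (hr : Continuous r) (m : FibreProduct s π → Z')
  (hm : ∀ e, π' (m e) = r e.1.1)

theorem push_ult_eq (p : FibreProduct s (base : EndPoint π → B)) (𝒲 : Ultrafilter I) (f : I → A)
    (k : I → Z) (h : ∀ i, s (f i) = π (k i)) (hf : Tendsto f 𝒲 (𝓝 p.1.1))
    (hk : 𝒲.map k = p.1.2.ult) :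
    (push hs hr m hm p).ult = 𝒲.map fun i => m ⟨(f i, k i), h i⟩ := by
  change (lift hs p).map m = _
  rw [← map_eq_lift hs p 𝒲 f k h hf hk, Ultrafilter.map_map]
  rfl

theorem push_liftPrincipal [T2Space B'] (e : FibreProduct s π) :
    push hs hr m hm (liftPrincipal e) = principal π' (m e) := by
  refine ext_ult ?_
  rw [push_ult_eq hs hr m hm (liftPrincipal e) (pure e) (fun e => e.1.1) (fun e => e.1.2)
    (fun e => e.2) (tendsto_pure_nhds _ _) (Ultrafilter.map_pure _ _)]
  exact Ultrafilter.map_pure _ _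

/-- Equality of the two filters gives continuity and openness of the extended map at once. -/
theorem map_push_nhds [T2Space B'] (p : FibreProduct s (base : EndPoint π → B)) :
    map (push hs hr m hm) (𝓝 p) = 𝓝 (push hs hr m hm p) := by
  rw [nhds_fibreProduct hs, nhds_eq, map_sup, map_pure, map_map]
  congr 1
  have : push hs hr m hm ∘ liftPrincipal = principal π' ∘ m :=
    funext (push_liftPrincipal hs hr m hm)
  rw [this, ← map_map]
  rfl

theorem continuous_push [T2Space B'] : Continuous (push hs hr m hm) :=
  continuous_iff_continuousAt.2 fun p => (map_push_nhds hs hr m hm p).le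

theorem isOpenMap_push [T2Space B'] : IsOpenMap (push hs hr m hm) :=
  IsOpenMap.of_nhds_le fun p => (map_push_nhds hs hr m hm p).ge

end Push

end EndPoint

theorem FibreProduct.tendsto_mk {A B C I : Type u} [TopologicalSpace A] [TopologicalSpace B]
    {f : A → C} {g : B → C} {l : Filter I} {v : I → A} {w : I → B} (h : ∀ i, f (v i) = g (w i))
    {a : A} {b : B} (hab : f a = g b) (hv : Tendsto v l (𝓝 a)) (hw : Tendsto w l (𝓝 b)) :
    Tendsto (fun i => (⟨(v i, w i), h i⟩ : FibreProduct f g)) l (𝓝 ⟨(a, b), hab⟩) :=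
  tendsto_subtype_rng.2 (hv.prodMk_nhds hw)

/-- As `R` is open, an ultrafilter whose image tends to a point of `R` lives on the preimage of `R`,
where properness supplies a limit. -/
theorem IsProperMap.exists_tendsto_of_restrictPreimage {Q B E : Type u} [TopologicalSpace Q]
    [TopologicalSpace B] {f : Q → B} {R : Set B} (hR : IsOpen R)
    (hf : IsProperMap (R.restrictPreimage f)) {𝒲 : Ultrafilter E} {k : E → Q} {b : B} (hb : b ∈ R)
    (h : Tendsto (fun e => f (k e)) 𝒲 (𝓝 b)) : ∃ q, Tendsto k 𝒲 (𝓝 q) := by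
  have hlarge : Set.range ((↑) : (f ⁻¹' R) → Q) ∈ 𝒲.map k := by
    rw [Subtype.range_coe]
    exact h (hR.mem_nhds hb)
  have hmap : map (↑) ((𝒲.map k).comap Subtype.val_injective hlarge : Filter (f ⁻¹' R)) =
      map k 𝒲 := by
    rw [Ultrafilter.coe_comap, map_comap, Ultrafilter.coe_map]
    exact inf_eq_left.2 (le_principal_iff.2 hlarge)
  have h' : Tendsto (R.restrictPreimage f) ((𝒲.map k).comap Subtype.val_injective hlarge)
      (𝓝 ⟨b, hb⟩) := by
    refine tendsto_subtype_rng.2 ?_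
    change Tendsto (f ∘ ((↑) : (f ⁻¹' R) → Q)) _ _
    refine tendsto_map'_iff.1 ?_
    rw [hmap]
    exact tendsto_map'_iff.2 h
  obtain ⟨⟨q, hq⟩, -, hle⟩ := hf.ultrafilter_le_nhds_of_tendsto h'
  refine ⟨q, ?_⟩
  rw [Tendsto, ← hmap]
  exact (continuous_subtype_val.tendsto (⟨q, hq⟩ : f ⁻¹' R)).mono_left hle

namespace EndPoint

variable {A₁ A₂ B B₁ Z : Type u} [TopologicalSpace A₁] [TopologicalSpace A₂]
  [TopologicalSpace B] [TopologicalSpace B₁]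
  {π : Z → B} {s₁ : A₁ → B₁} {s₂ : A₂ → B} {r₂ : A₂ → B₁}

/-- A point of `A₂` and an end point over it lift to a composable triple, up to the choice of an
ultrafilter on the set of all composable triples. -/
theorem exists_lift_lift (hs₁ : IsLocalHomeomorph s₁) (hs₂ : IsLocalHomeomorph s₂)
    (hr₂ : Continuous r₂) (a₁ : A₁) (a₂ : A₂) (y : EndPoint π) (p : s₁ a₁ = r₂ a₂)
    (q : s₂ a₂ = y.base) :
    ∃ 𝒲 : Ultrafilter (FibreProduct s₁ fun e : FibreProduct s₂ π => r₂ e.1.1),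
      Tendsto (fun i : FibreProduct s₁ fun e : FibreProduct s₂ π => r₂ e.1.1 => i.1.1) 𝒲 (𝓝 a₁) ∧
        𝒲.map (fun i => i.1.2) = lift hs₂ ⟨(a₂, y), q⟩ := by
  -- The lifted ultrafilter is an end point of the fibre product over `r₂`, so lifting once more
  -- reaches composable triples.
  let y' : EndPoint fun e : FibreProduct s₂ π => r₂ e.1.1 :=
    ⟨lift hs₂ ⟨(a₂, y), q⟩, r₂ a₂, (hr₂.tendsto _).comp (tendsto_lift hs₂ ⟨(a₂, y), q⟩)⟩
  exact ⟨lift hs₁ ⟨(a₁, y'), p⟩, tendsto_lift hs₁ _, map_lift hs₁ _⟩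

section Lift

variable {I : Type u} {hs₂ : IsLocalHomeomorph s₂} {p : FibreProduct s₂ (base : EndPoint π → B)}
  {𝒲 : Ultrafilter I} {k : I → FibreProduct s₂ π}

theorem tendsto_of_map_eq_lift (h : 𝒲.map k = lift hs₂ p) :
    Tendsto (fun i => (k i).1.1) 𝒲 (𝓝 p.1.1) := by
  have := tendsto_lift hs₂ p
  rw [← h] at this
  exact tendsto_map'_iff.1 this

theorem map_of_map_eq_lift (h : 𝒲.map k = lift hs₂ p) : 𝒲.map (fun i => (k i).1.2) = p.1.2.ult := by
  rw [← map_lift hs₂ p, ← h, Ultrafilter.map_map]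
  rfl

end Lift

end EndPoint

/-! ### Actions on the space of end points. -/

namespace LeftAction

variable {G : EtaleGroupoid.{u}} {Y : Type u} [TopologicalSpace Y] (L : LeftAction G Y)

/-- The extension of a left action to end points. -/
noncomputable def endPointAct :
    FibreProduct G.s (EndPoint.base : EndPoint L.anchor → G.Obj) → EndPoint L.anchor :=
  EndPoint.push G.isLocalHomeomorph_s G.isLocalHomeomorph_r.continuous
    (fun e => L.act e.1.1 e.1.2 e.2) (fun e => L.anchor_act e.1.1 e.1.2 e.2)

theorem endPointAct_ult {I : Type u} (g : G.Arr) (y : EndPoint L.anchor) (p : G.s g = y.base)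
    (𝒲 : Ultrafilter I) (f : I → G.Arr) (k : I → Y) (h : ∀ i, G.s (f i) = L.anchor (k i))
    (hf : Tendsto f 𝒲 (𝓝 g)) (hk : 𝒲.map k = y.ult) :
    (L.endPointAct ⟨(g, y), p⟩).ult = 𝒲.map fun i => L.act (f i) (k i) (h i) :=
  EndPoint.push_ult_eq _ _ _ _ ⟨(g, y), p⟩ 𝒲 f k h hf hk

/-- The action on the space of end points. -/
noncomputable def endPoint : LeftAction G (EndPoint L.anchor) where
  anchor := EndPoint.base
  act g y p := L.endPointAct ⟨(g, y), p⟩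
  continuous_anchor := EndPoint.continuous_base
  continuous_act := EndPoint.continuous_push _ _ _ _
  anchor_act _ _ _ := rfl
  act_act g h y p q := by
    -- Both sides are images of one ultrafilter on composable triples, so the identity is inherited
    -- pointwise from `L`. The mixed laws below follow in the same way.
    obtain ⟨𝒲, h1, h2⟩ := EndPoint.exists_lift_lift G.isLocalHomeomorph_s G.isLocalHomeomorph_s
      G.isLocalHomeomorph_r.continuous g h y p q
    have h3 := EndPoint.tendsto_of_map_eq_lift h2
    have h4 := EndPoint.map_of_map_eq_lift h2
    refine EndPoint.ext_ult ?_
    rw [L.endPointAct_ult g _ _ 𝒲 (fun i => i.1.1)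
        (fun i => L.act i.1.2.1.1 i.1.2.1.2 i.1.2.2)
        (fun i => i.2.trans (L.anchor_act _ _ _).symm) h1
        (by
          change 𝒲.map _ = (EndPoint.lift _ _).map _
          rw [← h2, Ultrafilter.map_map]
          rfl),
      L.endPointAct_ult _ y _ 𝒲 (fun i => G.mul i.1.1 i.1.2.1.1 i.2) (fun i => i.1.2.1.2)
        (fun i => (G.s_mul _ _ _).trans i.1.2.2)
        ((G.continuous_mul.tendsto ⟨(g, h), p⟩).comp (FibreProduct.tendsto_mk (fun i => i.2) p h1 h3))
        h4]
    exact congrArg 𝒲.map (funext fun i => L.act_act _ _ _ _ _)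
  unit_act y := by
    refine EndPoint.ext_ult ?_
    rw [L.endPointAct_ult _ y _ y.ult (fun z => G.unit (L.anchor z)) id (fun z => G.s_unit _)
      ((G.continuous_unit.tendsto _).comp y.tendsto) y.ult.map_id]
    exact (congrArg y.ult.map (funext fun z => L.unit_act z)).trans y.ult.map_id

end LeftAction

namespace CorrAction

variable {G : EtaleGroupoid.{u}} {C : Correspondence G G} {R : Set G.Obj}
  {Y : Type u} [TopologicalSpace Y] (a : CorrAction C R Y)

/-- The extension of the multiplication by elements of the correspondence to end points. -/
noncomputable def endPointXact :
    FibreProduct C.right.anchor (EndPoint.base : EndPoint a.anchor → G.Obj) → EndPoint a.anchor :=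
  EndPoint.push C.etale C.left.continuous_anchor
    (fun e => a.xact e.1.1 e.1.2 e.2) (fun e => a.anchor_xact e.1.1 e.1.2 e.2)

theorem endPointXact_ult {I : Type u} (x : C.carrier) (y : EndPoint a.anchor)
    (p : C.right.anchor x = y.base) (𝒲 : Ultrafilter I) (f : I → C.carrier) (k : I → Y)
    (h : ∀ i, C.right.anchor (f i) = a.anchor (k i)) (hf : Tendsto f 𝒲 (𝓝 x))
    (hk : 𝒲.map k = y.ult) :
    (a.endPointXact ⟨(x, y), p⟩).ult = 𝒲.map fun i => a.xact (f i) (k i) (h i) :=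
  EndPoint.push_ult_eq _ _ _ _ ⟨(x, y), p⟩ 𝒲 f k h hf hk

theorem endPointXact_principal (x : C.carrier) (y : Y) (p : C.right.anchor x = a.anchor y) :
    a.endPointXact ⟨(x, EndPoint.principal a.anchor y), p⟩ =
      EndPoint.principal a.anchor (a.xact x y p) :=
  EndPoint.push_liftPrincipal C.etale C.left.continuous_anchor
    (fun e => a.xact e.1.1 e.1.2 e.2) (fun e => a.anchor_xact e.1.1 e.1.2 e.2) ⟨(x, y), p⟩

theorem act_endPointXact (g : G.Arr) (x : C.carrier) (y : EndPoint a.anchor)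
    (p : G.s g = C.left.anchor x) (q : C.right.anchor x = y.base) :
    a.endPointAct ⟨(g, a.endPointXact ⟨(x, y), q⟩), p⟩ =
      a.endPointXact ⟨(C.left.act g x p, y), (C.s_left g x p).trans q⟩ := by
  obtain ⟨𝒲, h1, h2⟩ := EndPoint.exists_lift_lift G.isLocalHomeomorph_s C.etale
    C.left.continuous_anchor g x y p q
  have h3 := EndPoint.tendsto_of_map_eq_lift h2
  have h4 := EndPoint.map_of_map_eq_lift h2
  refine EndPoint.ext_ult ?_
  refine (a.endPointAct_ult g _ _ 𝒲 (fun i => i.1.1) (fun i => a.xact i.1.2.1.1 i.1.2.1.2 i.1.2.2)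
      (fun i => i.2.trans (a.anchor_xact _ _ _).symm) h1
      (by
        change 𝒲.map _ = (EndPoint.lift _ _).map _
        rw [← h2, Ultrafilter.map_map]
        rfl)).trans (Eq.trans ?_ (
    a.endPointXact_ult _ y _ 𝒲 (fun i => C.left.act i.1.1 i.1.2.1.1 i.2) (fun i => i.1.2.1.2)
      (fun i => (C.s_left _ _ _).trans i.1.2.2)
      ((C.left.continuous_act.tendsto ⟨(g, x), p⟩).comp
        (FibreProduct.tendsto_mk (fun i => i.2) p h1 h3)) h4).symm)
  exact congrArg 𝒲.map (funext fun i => a.act_xact _ _ _ _ _)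

theorem endPointXact_act (x : C.carrier) (g : G.Arr) (y : EndPoint a.anchor)
    (p : C.right.anchor x = G.r g) (q : G.s g = y.base) :
    a.endPointXact ⟨(x, a.endPointAct ⟨(g, y), q⟩), p⟩ =
      a.endPointXact ⟨(C.right.act x g p, y), (C.right.anchor_act x g p).trans q⟩ := by
  obtain ⟨𝒲, h1, h2⟩ := EndPoint.exists_lift_lift C.etale G.isLocalHomeomorph_s
    G.isLocalHomeomorph_r.continuous x g y p q
  have h3 := EndPoint.tendsto_of_map_eq_lift h2
  have h4 := EndPoint.map_of_map_eq_lift h2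
  refine EndPoint.ext_ult ?_
  refine (a.endPointXact_ult x _ _ 𝒲 (fun i => i.1.1) (fun i => a.act i.1.2.1.1 i.1.2.1.2 i.1.2.2)
      (fun i => i.2.trans (a.anchor_act _ _ _).symm) h1
      (by
        change 𝒲.map _ = (EndPoint.lift _ _).map _
        rw [← h2, Ultrafilter.map_map]
        rfl)).trans (Eq.trans ?_ (
    a.endPointXact_ult _ y _ 𝒲 (fun i => C.right.act i.1.1 i.1.2.1.1 i.2) (fun i => i.1.2.1.2)
      (fun i => (C.right.anchor_act _ _ _).trans i.1.2.2)
      ((C.right.continuous_act.tendsto ⟨(x, g), p⟩).comp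
        (FibreProduct.tendsto_mk (fun i => i.2) p h1 h3)) h4).symm)
  exact congrArg 𝒲.map (funext fun i => a.xact_act _ _ _ _ _)

/-- Equal products of ultrafilters give an ultrafilter on pairs of factorisations with equal
product. The arrows relating them in `Y` converge by properness of the right action on `X`, and
their limit relates the end points. -/
theorem exists_of_endPointXact_eq (x x' : C.carrier) (y y' : EndPoint a.anchor)
    (p : C.right.anchor x = y.base) (p' : C.right.anchor x' = y'.base)
    (h : a.endPointXact ⟨(x, y), p⟩ = a.endPointXact ⟨(x', y'), p'⟩) :
    ∃ (g : G.Arr) (q : C.right.anchor x = G.r g) (q' : G.s g = y'.base),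
      x' = C.right.act x g q ∧ y = a.endPointAct ⟨(g, y'), q'⟩ := by
  let E := FibreProduct C.right.anchor a.anchor
  let m : E → Y := fun e => a.xact e.1.1 e.1.2 e.2
  let I := {i : E × E // m i.1 = m i.2}
  set 𝒱 := EndPoint.lift C.etale ⟨(x, y), p⟩ with h𝒱
  set 𝒱' := EndPoint.lift C.etale ⟨(x', y'), p'⟩ with h𝒱'
  have hm : 𝒱.map m = 𝒱'.map m := congrArg EndPoint.ult h
  have hne : NeBot (comap (fun i : I => i.1.1) 𝒱 ⊓ comap (fun i : I => i.1.2) 𝒱') := by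
    rw [← forall_mem_nonempty_iff_neBot]
    rintro S hS
    obtain ⟨T, ⟨V, hV, hVT⟩, T', ⟨W, hW, hWT'⟩, rfl⟩ := mem_inf_iff.1 hS
    have h1 : m '' V ∈ 𝒱.map m := image_mem_map hV
    have h2 : m '' W ∈ 𝒱.map m := by
      rw [hm]
      exact image_mem_map hW
    obtain ⟨_, ⟨e, he, rfl⟩, e', he', hee'⟩ := Ultrafilter.nonempty_of_mem (inter_mem h1 h2)
    exact ⟨⟨(e, e'), hee'.symm⟩, hVT he, hWT' he'⟩
  obtain ⟨𝒲, h𝒲⟩ := Ultrafilter.exists_le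
    (comap (fun i : I => i.1.1) 𝒱 ⊓ comap (fun i : I => i.1.2) 𝒱')
  have h1 : 𝒲.map (fun i : I => i.1.1) = 𝒱 :=
    Ultrafilter.eq_of_le (map_le_iff_le_comap.2 (h𝒲.trans inf_le_left))
  have h2 : 𝒲.map (fun i : I => i.1.2) = 𝒱' :=
    Ultrafilter.eq_of_le (map_le_iff_le_comap.2 (h𝒲.trans inf_le_right))
  choose g q q' hx hy using fun i : I => (a.xact_eq_iff _ _ _ _ _ _).1 i.2
  have hlim : Tendsto (fun i : I => (C.right.act i.1.1.1.1 (g i) (q i), i.1.1.1.1)) 𝒲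
      (𝓝 (x', x)) := by
    simp only [← hx]
    exact (EndPoint.tendsto_of_map_eq_lift h2).prodMk_nhds (EndPoint.tendsto_of_map_eq_lift h1)
  have hlim' : Tendsto (fun p : FibreProduct C.right.anchor G.r =>
      (C.right.act p.1.1 p.1.2 p.2, p.1.1))
      (𝒲.map fun i => (⟨(i.1.1.1.1, g i), q i⟩ : FibreProduct C.right.anchor G.r))
      (𝓝 (x', x)) := tendsto_map'_iff.2 hlim
  obtain ⟨⟨⟨x₀, g₀⟩, q₀⟩, e, hle⟩ := C.proper.ultrafilter_le_nhds_of_tendsto hlim'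
  obtain ⟨e1, e2⟩ := Prod.ext_iff.1 e
  change C.right.act x₀ g₀ q₀ = x' at e1
  change x₀ = x at e2
  subst e2
  have hg : Tendsto g 𝒲 (𝓝 g₀) :=
    ((continuous_snd.comp continuous_subtype_val).tendsto
      (⟨(x₀, g₀), q₀⟩ : FibreProduct C.right.anchor G.r)).comp hle
  have q₀' : G.s g₀ = y'.base := by
    rw [← p', ← e1, C.right.anchor_act]
  refine ⟨g₀, q₀, q₀', e1.symm, EndPoint.ext_ult ?_⟩
  rw [a.endPointAct_ult g₀ y' q₀' 𝒲 g (fun i => i.1.2.1.2) q' hg (EndPoint.map_of_map_eq_lift h2),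
    ← EndPoint.map_of_map_eq_lift (p := ⟨(x₀, y), p⟩) h1]
  exact congrArg 𝒲.map (funext hy)

/-- If the elements of the correspondence that occur in the factorisation of an ultrafilter
converge up to the right action, then its end point factorises. -/
theorem exists_endPointXact_eq (y : EndPoint a.anchor)
    (𝒲 : Ultrafilter (FibreProduct C.right.anchor a.anchor))
    (h : 𝒲.map (fun e => a.xact e.1.1 e.1.2 e.2) = y.ult) (x : C.carrier)
    (hx : Tendsto (fun e : FibreProduct C.right.anchor a.anchor => C.right.proj e.1.1) 𝒲
      (𝓝 (C.right.proj x))) :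
    ∃ (y' : EndPoint a.anchor) (p : C.right.anchor x = y'.base),
      a.endPointXact ⟨(x, y'), p⟩ = y := by
  obtain ⟨𝒱, h1, h2⟩ := C.right.exists_ultrafilter_tendsto
    (fun e : FibreProduct C.right.anchor a.anchor => e.1.1) (fun e => a.xact e.1.1 e.1.2 e.2)
    (by
      rintro ⟨⟨x₀, z⟩, p⟩ x' hx'
      obtain ⟨g, q, rfl⟩ := C.right.proj_eq_proj_iff.1 hx'.symm
      refine ⟨⟨(C.right.act x₀ g q, a.act (G.inv g) z ((G.s_inv g).trans (q.symm.trans p))), ?_⟩,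
        rfl, ?_⟩
      · rw [C.right.anchor_act, a.anchor_act, G.r_inv]
      · dsimp only
        rw [← a.xact_act x₀ g _ q ((G.r_inv g).symm.trans (a.anchor_act _ _ _).symm)]
        exact a.xact_congr rfl (a.act_inv_act g z (q.symm.trans p)) _ _)
    𝒲 x hx
  -- The second factors form an end point over `s(x)`, because their anchors are the sources of
  -- first factors converging to `x`.
  have hlim : Tendsto a.anchor (𝒱.map fun e => e.1.2) (𝓝 (C.right.anchor x)) := by
    refine tendsto_map'_iff.2 ?_
    have : a.anchor ∘ (fun e : FibreProduct C.right.anchor a.anchor => e.1.2) =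
      fun e => C.right.anchor e.1.1 := funext fun e => e.2.symm
    rw [this]
    exact (C.right.continuous_anchor.tendsto x).comp h1
  refine ⟨⟨_, _, hlim⟩, rfl, EndPoint.ext_ult ?_⟩
  rw [a.endPointXact_ult x _ _ 𝒱 (fun e => e.1.1) (fun e => e.1.2) (fun e => e.2) h1 rfl, h2, h]

/-- The action on the space of end points. -/
noncomputable def endPoint (hR : IsOpen R) (hC : C.IsRegularOn R) :
    CorrAction C R (EndPoint a.anchor) where
  toLeftAction := a.toLeftAction.endPoint
  xact x y p := a.endPointXact ⟨(x, y), p⟩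
  continuous_xact := EndPoint.continuous_push _ _ _ _
  isOpenMap_xact := EndPoint.isOpenMap_push _ _ _ _
  anchor_xact _ _ _ := rfl
  act_xact := a.act_endPointXact
  xact_eq_iff x x' y y' p p' := by
    refine ⟨a.exists_of_endPointXact_eq x x' y y' p p', ?_⟩
    rintro ⟨g, q, q', rfl, rfl⟩
    exact a.endPointXact_act x g y' q q'
  covers y hy := by
    -- Since `R` is open, almost all points of `y.ult` factorise. Their classes in `X / G` converge
    -- by regularity, because their images under `r_*` tend to `y.base ∈ R`.
    have h1 : (fun e : FibreProduct C.right.anchor a.anchor => a.xact e.1.1 e.1.2 e.2) ''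
        Set.univ ∈ y.ult := by
      refine mem_of_superset (y.tendsto (hR.mem_nhds hy)) fun z hz => ?_
      obtain ⟨x, y', p, e⟩ := a.covers z hz
      exact ⟨⟨(x, y'), p⟩, trivial, e⟩
    have h2 := Ultrafilter.ofComapInfPrincipal_eq_of_map h1
    set 𝒲 := Ultrafilter.ofComapInfPrincipal h1
    have h3 : Tendsto (fun e : FibreProduct C.right.anchor a.anchor =>
        C.rStar (C.right.proj e.1.1)) 𝒲 (𝓝 y.base) := by
      have h4 := y.tendsto
      rw [← h2] at h4
      refine (tendsto_map'_iff.1 h4).congr fun e => ?_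
      exact a.anchor_xact _ _ _
    obtain ⟨q, hq⟩ := hC.1.exists_tendsto_of_restrictPreimage hR hy h3
    induction q using Quotient.inductionOn with
    | h x =>
      obtain ⟨y', p, e⟩ := a.exists_endPointXact_eq y 𝒲 h2 x hq
      exact ⟨x, y', p, e⟩
  closed K hK := by
    refine isOpen_compl_iff.1 (isOpen_iff_mem_nhds.2 fun y hy => ?_)
    rw [EndPoint.nhds_eq]
    refine ⟨hy, ?_⟩
    by_contra hcon
    have h0 : (EndPoint.principal a.anchor ⁻¹' {z | ∃ (x : C.carrier) (y : EndPoint a.anchor)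
        (p : C.right.anchor x = y.base), C.right.proj x ∈ K ∧ a.endPointXact ⟨(x, y), p⟩ = z}) ∈
        y.ult := Ultrafilter.compl_notMem_iff.1 hcon
    have h1 : (fun e : FibreProduct C.right.anchor a.anchor => a.xact e.1.1 e.1.2 e.2) ''
        {e | C.right.proj e.1.1 ∈ K} ∈ y.ult := by
      refine mem_of_superset h0 ?_
      rintro z ⟨x, y', p, hxK, e⟩
      -- A factorisation of a principal end point comes from one of `z` itself. Uniqueness up to `G`
      -- puts its first factor in the same orbit, so its class still lies in `K`.
      have h2 : (fun e : FibreProduct C.right.anchor a.anchor => a.xact e.1.1 e.1.2 e.2) ⁻¹' {z} ∈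
          EndPoint.lift C.etale ⟨(x, y'), p⟩ := by
        have := congrArg EndPoint.ult e
        rw [← Ultrafilter.mem_map]
        change {z} ∈ (a.endPointXact ⟨(x, y'), p⟩).ult
        rw [this]
        exact Ultrafilter.mem_pure.2 rfl
      obtain ⟨⟨⟨x₁, z₁⟩, p₁⟩, e₁ : a.xact x₁ z₁ p₁ = z⟩ := Ultrafilter.nonempty_of_mem h2
      refine ⟨⟨(x₁, z₁), p₁⟩, ?_, e₁⟩
      rw [← e₁, ← a.endPointXact_principal] at e
      obtain ⟨g, q, -, rfl, -⟩ := a.exists_of_endPointXact_eq _ _ _ _ _ _ e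
      change C.right.proj _ ∈ K
      rwa [C.right.proj_act]
    have h2 := Ultrafilter.ofComapInfPrincipal_eq_of_map h1
    have h3 := Ultrafilter.ofComapInfPrincipal_mem h1
    set 𝒲 := Ultrafilter.ofComapInfPrincipal h1
    obtain ⟨q, hqK, hq⟩ := hK.ultrafilter_le_nhds'
      (𝒲.map fun e : FibreProduct C.right.anchor a.anchor => C.right.proj e.1.1) h3
    induction q using Quotient.inductionOn with
    | h x =>
      obtain ⟨y', p, e⟩ := a.exists_endPointXact_eq y 𝒲 h2 x hq
      exact hy ⟨x, y', p, hqK, e⟩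

end CorrAction

/-! ### Restriction to invariant subsets, made discrete. -/

/-- A subset with the discrete topology. -/
structure DiscreteSubset {Y : Type u} (S : Set Y) : Type u where
  val : Y
  mem : val ∈ S

namespace DiscreteSubset

variable {Y : Type u} {S : Set Y}

instance : TopologicalSpace (DiscreteSubset S) := ⊥

instance : DiscreteTopology (DiscreteSubset S) := ⟨rfl⟩

theorem ext_val {y y' : DiscreteSubset S} (h : y.val = y'.val) : y = y' := by
  cases y; cases y'; cases h; rfl

end DiscreteSubset

/-- The restriction of a left action to an invariant subset, made discrete. -/
def LeftAction.discrete {G : EtaleGroupoid.{u}} {Y : Type u} [TopologicalSpace Y]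
    (L : LeftAction G Y) (S : Set Y) (hS : ∀ g y p, y ∈ S → L.act g y p ∈ S) :
    LeftAction G (DiscreteSubset S) where
  anchor y := L.anchor y.val
  act g y p := ⟨L.act g y.val p, hS g y.val p y.mem⟩
  continuous_anchor := continuous_of_discreteTopology
  continuous_act := by
    have := FibreProduct.discreteTopology G.isLocalHomeomorph_s
      fun y : DiscreteSubset S => L.anchor y.val
    exact continuous_of_discreteTopology
  anchor_act g y p := L.anchor_act g y.val p
  act_act g h y p q := DiscreteSubset.ext_val (L.act_act g h y.val p q)
  unit_act y := DiscreteSubset.ext_val (L.unit_act y.val)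

theorem LeftAction.discrete_equivariant_val {G : EtaleGroupoid.{u}} {Y : Type u}
    [TopologicalSpace Y] (L : LeftAction G Y) (S : Set Y)
    (hS : ∀ g y p, y ∈ S → L.act g y p ∈ S) :
    LeftAction.Equivariant (L.discrete S hS) L DiscreteSubset.val :=
  ⟨fun _ => rfl, fun _ _ _ => rfl⟩

namespace CorrAction

variable {G : EtaleGroupoid.{u}} {C : Correspondence G G} {R : Set G.Obj}
  {Y Y₁ Y₂ : Type u} [TopologicalSpace Y] [TopologicalSpace Y₁] [TopologicalSpace Y₂]

theorem Equivariant.toLeftAction {a₁ : CorrAction C R Y₁} {a₂ : CorrAction C R Y₂} {f : Y₁ → Y₂}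
    (h : Equivariant a₁ a₂ f) : LeftAction.Equivariant a₁.toLeftAction a₂.toLeftAction f := by
  obtain ⟨⟨h1, h2, -⟩, -⟩ := h
  exact ⟨h1, h2⟩

variable (a : CorrAction C R Y) (S : Set Y) (hS : ∀ g y p, y ∈ S → a.act g y p ∈ S)
  (hX : ∀ x y p, a.xact x y p ∈ S ↔ y ∈ S)

/-- The restriction of an action to an invariant subset, made discrete. -/
def discrete : CorrAction C R (DiscreteSubset S) where
  toLeftAction := a.toLeftAction.discrete S hS
  xact x y p := ⟨a.xact x y.val p, (hX x y.val p).2 y.mem⟩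
  continuous_xact := by
    have := FibreProduct.discreteTopology C.etale (a.toLeftAction.discrete S hS).anchor
    exact continuous_of_discreteTopology
  isOpenMap_xact := fun _ _ => isOpen_discrete _
  anchor_xact x y p := a.anchor_xact x y.val p
  act_xact g x y p q := DiscreteSubset.ext_val (a.act_xact g x y.val p q)
  xact_eq_iff x x' y y' p p' := by
    constructor
    · intro h
      obtain ⟨g, q, q', hx, hy⟩ := (a.xact_eq_iff x x' y.val y'.val p p').1
        (congrArg DiscreteSubset.val h)
      exact ⟨g, q, q', hx, DiscreteSubset.ext_val hy⟩
    · rintro ⟨g, q, q', hx, hy⟩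
      exact DiscreteSubset.ext_val ((a.xact_eq_iff x x' y.val y'.val p p').2
        ⟨g, q, q', hx, congrArg DiscreteSubset.val hy⟩)
  covers y hy := by
    obtain ⟨x, z, p, e⟩ := a.covers y.val hy
    exact ⟨x, ⟨z, (hX x z p).1 (e ▸ y.mem)⟩, p, DiscreteSubset.ext_val e⟩
  closed _ _ := isClosed_discrete _

theorem discrete_equivariant_val :
    Equivariant (a.discrete S hS hX) a DiscreteSubset.val := by
  refine ⟨⟨fun _ => rfl, fun _ _ _ => rfl, fun _ _ _ => rfl⟩, ?_⟩
  ext y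
  constructor
  · rintro ⟨x, z, p, e⟩
    exact ⟨x, ⟨z, (hX x z p).1 (e ▸ y.mem)⟩, p, DiscreteSubset.ext_val e⟩
  · rintro ⟨x, z, p, e⟩
    exact ⟨x, z.val, p, congrArg DiscreteSubset.val e⟩

end CorrAction

/-! ### The terminal action on `M⁰` and properness of its anchor map. -/

/-- The canonical action of a groupoid on its object space. -/
def EtaleGroupoid.objAction (M : EtaleGroupoid.{u}) : LeftAction M M.Obj where
  anchor := id
  act m _ _ := M.r m
  continuous_anchor := continuous_id
  continuous_act :=
    M.isLocalHomeomorph_r.continuous.comp (continuous_fst.comp continuous_subtype_val)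
  anchor_act _ _ _ := rfl
  act_act g h _ p _ := (M.r_mul g h p).symm
  unit_act y := M.r_unit y

theorem LeftAction.equivariant_anchor {M : EtaleGroupoid.{u}} {Y : Type u} [TopologicalSpace Y]
    (L : LeftAction M Y) : LeftAction.Equivariant L M.objAction L.anchor :=
  ⟨fun _ => rfl, fun g y p => L.anchor_act g y p⟩

namespace GroupoidModel

variable {G : EtaleGroupoid.{u}} {C : Correspondence G G} {R : Set G.Obj}
  (𝓜 : GroupoidModel C R)

/-- The action on the object space of the groupoid model. -/
noncomputable def objCorrAction : CorrAction C R 𝓜.M.Obj :=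
  (𝓜.equiv 𝓜.M.Obj).symm 𝓜.M.objAction

/-- `M⁰` is terminal among `M`-actions, the unique equivariant map being the anchor map; the model
transports this to `(G, X, R)`-actions. -/
theorem equivariant_objCorrAction_iff {Y : Type u} [TopologicalSpace Y] (a : CorrAction C R Y)
    (f : Y → 𝓜.M.Obj) (hf : Continuous f) :
    CorrAction.Equivariant a 𝓜.objCorrAction f ↔ f = (𝓜.equiv Y a).anchor := by
  rw [𝓜.natural _ _ _ _ f hf, objCorrAction, Equiv.apply_symm_apply]
  constructor
  · rintro ⟨h, -⟩
    exact funext h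
  · rintro rfl
    exact LeftAction.equivariant_anchor _

theorem objCorrAction_anchor {Y : Type u} [TopologicalSpace Y] (a : CorrAction C R Y) (y : Y) :
    𝓜.objCorrAction.anchor ((𝓜.equiv Y a).anchor y) = a.anchor y := by
  obtain ⟨⟨h, -⟩, -⟩ := (𝓜.equivariant_objCorrAction_iff a _ (𝓜.equiv Y a).continuous_anchor).2 rfl
  exact h y

/-- The anchor map from the object space of the groupoid model is proper. -/
theorem isProperMap_objCorrAction_anchor (hR : IsOpen R) (hC : C.IsRegularOn R) :
    IsProperMap 𝓜.objCorrAction.anchor := by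
  set a := 𝓜.objCorrAction with ha
  let b := a.endPoint hR hC
  -- The discrete copy of `M⁰` makes the map to principal end points continuous, so naturality
  -- applies to it.
  let d := a.discrete Set.univ (fun _ _ _ _ => trivial) (fun _ _ _ => Iff.rfl)
  have h1 : ∀ z, z.val = (𝓜.equiv _ d).anchor z := congrFun
    ((𝓜.equivariant_objCorrAction_iff d _ continuous_of_discreteTopology).1
      (a.discrete_equivariant_val _ _ _))
  have h2 : CorrAction.Equivariant d b fun z => EndPoint.principal a.anchor z.val := by
    refine ⟨⟨fun _ => rfl, fun g z p => ?_, fun x z p => ?_⟩, ?_⟩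
    · exact (EndPoint.push_liftPrincipal G.isLocalHomeomorph_s G.isLocalHomeomorph_r.continuous
        (fun e => a.act e.1.1 e.1.2 e.2) (fun e => a.anchor_act e.1.1 e.1.2 e.2)
        ⟨(g, z.val), p⟩).symm
    · exact (a.endPointXact_principal x z.val p).symm
    · ext z
      constructor
      · rintro ⟨x, y, p, e⟩
        have h3 : (a.endPointXact ⟨(x, y), p⟩).ult = pure z.val := congrArg EndPoint.ult e
        have h4 : (fun e : FibreProduct C.right.anchor a.anchor => a.xact e.1.1 e.1.2 e.2) ⁻¹'
            {z.val} ∈ EndPoint.lift C.etale ⟨(x, y), p⟩ := by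
          rw [← Ultrafilter.mem_map]
          change {z.val} ∈ (a.endPointXact ⟨(x, y), p⟩).ult
          rw [h3]
          exact Ultrafilter.mem_pure.2 rfl
        obtain ⟨⟨⟨x₁, z₁⟩, p₁⟩, e₁⟩ := Ultrafilter.nonempty_of_mem h4
        exact ⟨x₁, ⟨z₁, trivial⟩, p₁, DiscreteSubset.ext_val e₁⟩
      · rintro ⟨x, y, p, rfl⟩
        exact ⟨x, EndPoint.principal a.anchor y.val, p, a.endPointXact_principal x y.val p⟩
  obtain ⟨h3, -⟩ := (𝓜.natural _ _ _ _ _ continuous_of_discreteTopology).1 h2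
  rw [isProperMap_iff_ultrafilter_of_t2]
  refine ⟨a.continuous_anchor, fun 𝒰 p hp => ?_⟩
  let y : EndPoint a.anchor := ⟨𝒰, p, hp⟩
  refine ⟨(𝓜.equiv _ b).anchor y, ?_⟩
  -- The principal end points of points of `M⁰` tend to `y` along `𝒰`. The anchor map sends them
  -- back to those points, so `𝒰` itself converges.
  have h4 := ((𝓜.equiv _ b).continuous_anchor.tendsto y).comp y.tendsto_principal
  have h5 : (𝓜.equiv _ b).anchor ∘ EndPoint.principal a.anchor = id :=
    funext fun z => (h3 ⟨z, trivial⟩).trans (h1 ⟨z, trivial⟩).symm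
  rw [h5] at h4
  exact h4

end GroupoidModel

/-! ### Right invariance expressed through equivariant maps. -/

section RightInvariance

variable {G H : EtaleGroupoid.{u}}

/-- The arrows with a given source, as a discrete space. -/
abbrev EtaleGroupoid.SourceFibre (H : EtaleGroupoid.{u}) (ω : H.Obj) : Type u :=
  DiscreteSubset {h : H.Arr | H.s h = ω}

/-- Right translation by an arrow. -/
def EtaleGroupoid.rightTranslation (H : EtaleGroupoid.{u}) (k : H.Arr)
    (h : H.SourceFibre (H.r k)) : H.Arr :=
  H.mul h.val k h.mem

/-- A left action on the arrow space of a groupoid that commutes with right translations. -/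
structure LeftAction.IsRightInvariant (L : LeftAction G H.Arr) : Prop where
  s_act : ∀ m h p, H.s (L.act m h p) = H.s h
  anchor_mul : ∀ h k p, L.anchor (H.mul h k p) = L.anchor h
  act_mul : ∀ (m : G.Arr) (h k : H.Arr) (p : G.s m = L.anchor h) (q : H.s h = H.r k),
    H.mul (L.act m h p) k ((s_act m h p).trans q) =
      L.act m (H.mul h k q) (p.trans (anchor_mul h k q).symm)

/-- Equivariance of the inclusion of a source fibre says that sources are preserved. Comparing the
inclusion with right translation, for the same action on the fibre, gives commutation with
multiplication by `k`. -/
theorem LeftAction.isRightInvariant_of_fibres (L : LeftAction G H.Arr)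
    (L' : ∀ ω, LeftAction G (H.SourceFibre ω))
    (h1 : ∀ ω, LeftAction.Equivariant (L' ω) L DiscreteSubset.val)
    (h2 : ∀ k, LeftAction.Equivariant (L' (H.r k)) L (H.rightTranslation k)) :
    L.IsRightInvariant := by
  have hs : ∀ m h p, H.s (L.act m h p) = H.s h := by
    intro m h p
    obtain ⟨e, he⟩ := h1 (H.s h)
    have := he m ⟨h, rfl⟩ (p.trans (e ⟨h, rfl⟩))
    rw [← this]
    exact ((L' (H.s h)).act m ⟨h, rfl⟩ (p.trans (e ⟨h, rfl⟩))).mem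
  have hm : ∀ h k p, L.anchor (H.mul h k p) = L.anchor h := by
    intro h k p
    obtain ⟨e, -⟩ := h1 (H.r k)
    obtain ⟨e', -⟩ := h2 k
    exact (e' ⟨h, p⟩).trans (e ⟨h, p⟩).symm
  refine ⟨hs, hm, fun m h k p q => ?_⟩
  obtain ⟨e, he⟩ := h1 (H.r k)
  obtain ⟨e', he'⟩ := h2 k
  refine Eq.trans ?_ (he' m ⟨h, q⟩ (p.trans (e ⟨h, q⟩)))
  exact H.mul_congr (he m ⟨h, q⟩ (p.trans (e ⟨h, q⟩))).symm rfl _ _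

theorem LeftAction.IsRightInvariant.exists_fibres {L : LeftAction G H.Arr}
    (hL : L.IsRightInvariant) :
    ∃ L' : ∀ ω, LeftAction G (H.SourceFibre ω),
      (∀ ω, LeftAction.Equivariant (L' ω) L DiscreteSubset.val) ∧
      ∀ k, LeftAction.Equivariant (L' (H.r k)) L (H.rightTranslation k) := by
  refine ⟨fun ω => L.discrete _ fun g h p hh => (hL.s_act g h p).trans hh, fun ω =>
    L.discrete_equivariant_val _ _, fun k => ⟨fun h => hL.anchor_mul h.val k h.mem, ?_⟩⟩
  exact fun m h p => hL.act_mul m h.val k p h.mem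

variable {C : Correspondence G G} {R : Set G.Obj}

/-- A `(G, X, R)`-action on the arrow space of a groupoid that commutes with right translations. -/
structure CorrAction.IsRightInvariant (a : CorrAction C R H.Arr) : Prop extends
    a.toLeftAction.IsRightInvariant where
  s_xact : ∀ x h p, H.s (a.xact x h p) = H.s h
  xact_mul : ∀ (x : C.carrier) (h k : H.Arr) (p : C.right.anchor x = a.anchor h)
    (q : H.s h = H.r k), H.mul (a.xact x h p) k ((s_xact x h p).trans q) =
      a.xact x (H.mul h k q) (p.trans (anchor_mul h k q).symm)

theorem CorrAction.isRightInvariant_of_fibres (a : CorrAction C R H.Arr)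
    (a' : ∀ ω, CorrAction C R (H.SourceFibre ω))
    (h1 : ∀ ω, CorrAction.Equivariant (a' ω) a DiscreteSubset.val)
    (h2 : ∀ k, CorrAction.Equivariant (a' (H.r k)) a (H.rightTranslation k)) :
    a.IsRightInvariant := by
  have hs : ∀ x h p, H.s (a.xact x h p) = H.s h := by
    intro x h p
    obtain ⟨⟨e, -, he⟩, -⟩ := h1 (H.s h)
    have := he x ⟨h, rfl⟩ (p.trans (e ⟨h, rfl⟩))
    rw [← this]
    exact ((a' (H.s h)).xact x ⟨h, rfl⟩ (p.trans (e ⟨h, rfl⟩))).mem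
  refine ⟨a.toLeftAction.isRightInvariant_of_fibres (fun ω => (a' ω).toLeftAction)
    (fun ω => (h1 ω).toLeftAction) fun k => (h2 k).toLeftAction, hs, fun x h k p q => ?_⟩
  obtain ⟨⟨e, -, he⟩, -⟩ := h1 (H.r k)
  obtain ⟨⟨e', -, he'⟩, -⟩ := h2 k
  refine Eq.trans ?_ (he' x ⟨h, q⟩ (p.trans (e ⟨h, q⟩)))
  exact H.mul_congr (he x ⟨h, q⟩ (p.trans (e ⟨h, q⟩))).symm rfl _ _

theorem CorrAction.IsRightInvariant.exists_fibres {a : CorrAction C R H.Arr}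
    (ha : a.IsRightInvariant) :
    ∃ a' : ∀ ω, CorrAction C R (H.SourceFibre ω),
      (∀ ω, CorrAction.Equivariant (a' ω) a DiscreteSubset.val) ∧
      ∀ k, CorrAction.Equivariant (a' (H.r k)) a (H.rightTranslation k) := by
  refine ⟨fun ω => a.discrete _ (fun g h p hh => (ha.s_act g h p).trans hh)
    (fun x h p => (ha.s_xact x h p).congr_left), fun ω =>
    a.discrete_equivariant_val _ _ _, fun k => ⟨⟨fun h => ha.anchor_mul h.val k h.mem,
      fun m h p => ha.act_mul m h.val k p h.mem, fun x h p => ha.xact_mul x h.val k p h.mem⟩, ?_⟩⟩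
  ext h
  constructor
  · rintro ⟨x, z, p, e⟩
    -- The condition on preimages of `X · Y` holds because right translation is invertible: a
    -- factorisation of `h k` is translated back by `k⁻¹`.
    have hz : H.s z = H.r (H.inv k) := by
      rw [← ha.s_xact x z p, e, H.r_inv]
      exact H.s_mul _ _ _
    refine ⟨x, ⟨H.mul z (H.inv k) hz, (H.s_mul _ _ _).trans (H.s_inv k)⟩,
      p.trans (ha.anchor_mul _ _ _).symm, DiscreteSubset.ext_val ?_⟩
    refine (ha.xact_mul x z (H.inv k) p hz).symm.trans ?_
    refine (H.mul_congr e rfl _ ((H.s_mul _ _ _).trans (H.r_inv k).symm)).trans ?_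
    exact H.mul_inv_cancel_right h.val k h.mem
  · rintro ⟨x, z, p, rfl⟩
    exact ⟨x, H.mul z.val k z.mem, p.trans (ha.anchor_mul _ _ _).symm,
      (ha.xact_mul x z.val k p z.mem).symm⟩

/-- Each side amounts to the existence of fibre actions with equivariant inclusions and
translations, and naturality of the model transports these. -/
theorem GroupoidModel.isRightInvariant_iff (𝓜 : GroupoidModel C R) (a : CorrAction C R H.Arr) :
    a.IsRightInvariant ↔ (𝓜.equiv H.Arr a).IsRightInvariant := by
  constructor
  · intro ha
    obtain ⟨a', h1, h2⟩ := ha.exists_fibres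
    exact LeftAction.isRightInvariant_of_fibres _ (fun ω => 𝓜.equiv _ (a' ω))
      (fun ω => (𝓜.natural _ _ _ _ _ continuous_of_discreteTopology).1 (h1 ω))
      (fun k => (𝓜.natural _ _ _ _ _ continuous_of_discreteTopology).1 (h2 k))
  · intro hL
    obtain ⟨L', h1, h2⟩ := hL.exists_fibres
    refine CorrAction.isRightInvariant_of_fibres _ (fun ω => (𝓜.equiv _).symm (L' ω))
      (fun ω => (𝓜.natural _ _ _ _ _ continuous_of_discreteTopology).2 ?_)
      (fun k => (𝓜.natural _ _ _ _ _ continuous_of_discreteTopology).2 ?_)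
    · rw [Equiv.apply_symm_apply]
      exact h1 ω
    · rw [Equiv.apply_symm_apply]
      exact h2 k

end RightInvariance

theorem CorrAction.ext_of_eq {G : EtaleGroupoid.{u}} {C : Correspondence G G} {R : Set G.Obj}
    {Y : Type u} [TopologicalSpace Y] {a a' : CorrAction C R Y} (h : ∀ y, a.anchor y = a'.anchor y)
    (hact : ∀ g y p, a.act g y p = a'.act g y (p.trans (h y)))
    (hxact : ∀ x y p, a.xact x y p = a'.xact x y (p.trans (h y))) : a = a' := by
  obtain ⟨⟨n, m⟩, k⟩ := a
  obtain ⟨⟨n', m'⟩, k'⟩ := a'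
  obtain rfl : n = n' := funext h
  obtain rfl : m = m' := funext fun g => funext fun y => funext fun p => hact g y p
  obtain rfl : k = k' := funext fun x => funext fun y => funext fun p => hxact x y p
  rfl

theorem Actor.ext_toLeftAction {M H : EtaleGroupoid.{u}} {A A' : Actor M H}
    (h : A.toLeftAction = A'.toLeftAction) : A = A' := by
  obtain ⟨L⟩ := A
  obtain ⟨L'⟩ := A'
  obtain rfl : L = L' := h
  rfl

theorem Actor.isRightInvariant {M H : EtaleGroupoid.{u}} (A : Actor M H) :
    A.toLeftAction.IsRightInvariant :=
  ⟨A.s_act, A.anchor_mul, A.act_mul⟩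

/-! ### Triples and the actions on arrow spaces that they define. -/

namespace ActorData

variable {G H : EtaleGroupoid.{u}} {C : Correspondence G G} {R : Set G.Obj}

theorem ext_of_eq {t t' : ActorData C H} (h : ∀ ω, t.rho ω = t'.rho ω)
    (hG : ∀ g ω p, t.muG g ω p = t'.muG g ω (p.trans (h ω)))
    (hX : ∀ x ω p, t.muX x ω p = t'.muX x ω (p.trans (h ω))) : t = t' := by
  obtain ⟨n, m, k⟩ := t
  obtain ⟨n', m', k'⟩ := t'
  obtain rfl : n = n' := funext h
  obtain rfl : m = m' := funext fun g => funext fun y => funext fun p => hG g y p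
  obtain rfl : k = k' := funext fun x => funext fun y => funext fun p => hX x y p
  rfl

variable (t : ActorData C H)

theorem muG_congr {g g' : G.Arr} {ω ω' : H.Obj} (hg : g = g') (hω : ω = ω')
    (p : G.s g = t.rho ω) (p' : G.s g' = t.rho ω') : t.muG g ω p = t.muG g' ω' p' := by
  subst hg hω; rfl

theorem muX_congr {x x' : C.carrier} {ω ω' : H.Obj} (hx : x = x') (hω : ω = ω')
    (p : C.right.anchor x = t.rho ω) (p' : C.right.anchor x' = t.rho ω') :
    t.muX x ω p = t.muX x' ω' p' := by
  subst hx hω; rfl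

theorem gmul_congr {g g' : G.Arr} {h h' : H.Arr} (hg : g = g') (hh : h = h')
    (p : G.s g = t.rho (H.r h)) (p' : G.s g' = t.rho (H.r h')) :
    t.gmul g h p = t.gmul g' h' p' := by
  subst hg hh; rfl

theorem xmul_congr {x x' : C.carrier} {h h' : H.Arr} (hx : x = x') (hh : h = h')
    (p : C.right.anchor x = t.rho (H.r h)) (p' : C.right.anchor x' = t.rho (H.r h')) :
    t.xmul x h p = t.xmul x' h' p' := by
  subst hx hh; rfl

theorem s_gmul (g : G.Arr) (h : H.Arr) (p : G.s g = t.rho (H.r h)) :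
    H.s (t.gmul g h p) = H.s h :=
  H.s_mul _ _ _

theorem s_xmul (x : C.carrier) (h : H.Arr) (p : C.right.anchor x = t.rho (H.r h)) :
    H.s (t.xmul x h p) = H.s h :=
  H.s_mul _ _ _

theorem r_xmul (x : C.carrier) (h : H.Arr) (p : C.right.anchor x = t.rho (H.r h)) :
    H.r (t.xmul x h p) = H.r (t.muX x (H.r h) p) :=
  H.r_mul _ _ _

theorem gmul_mul (g : G.Arr) (h k : H.Arr) (p : G.s g = t.rho (H.r h)) (q : H.s h = H.r k) :
    H.mul (t.gmul g h p) k ((t.s_gmul g h p).trans q) =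
      t.gmul g (H.mul h k q) (p.trans (congrArg t.rho (H.r_mul h k q).symm)) := by
  refine (H.mul_assoc _ h k (t.s_muG g (H.r h) p) q).trans ?_
  exact H.mul_congr (t.muG_congr rfl (H.r_mul h k q).symm _ _) rfl _ _

theorem xmul_mul (x : C.carrier) (h k : H.Arr) (p : C.right.anchor x = t.rho (H.r h))
    (q : H.s h = H.r k) :
    H.mul (t.xmul x h p) k ((t.s_xmul x h p).trans q) =
      t.xmul x (H.mul h k q) (p.trans (congrArg t.rho (H.r_mul h k q).symm)) := by
  refine (H.mul_assoc _ h k (t.s_muX x (H.r h) p) q).trans ?_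
  exact H.mul_congr (t.muX_congr rfl (H.r_mul h k q).symm _ _) rfl _ _

theorem gmul_unit (g : G.Arr) (ω : H.Obj) (p : G.s g = t.rho (H.r (H.unit ω))) :
    t.gmul g (H.unit ω) p = t.muG g ω (p.trans (congrArg t.rho (H.r_unit ω))) := by
  refine Eq.trans ?_ (H.mul_unit _)
  exact H.mul_congr (t.muG_congr rfl (H.r_unit ω) _ _) (congrArg H.unit (t.s_muG _ _ _).symm) _ _

theorem xmul_unit (x : C.carrier) (ω : H.Obj) (p : C.right.anchor x = t.rho (H.r (H.unit ω))) :
    t.xmul x (H.unit ω) p = t.muX x ω (p.trans (congrArg t.rho (H.r_unit ω))) := by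
  refine Eq.trans ?_ (H.mul_unit _)
  exact H.mul_congr (t.muX_congr rfl (H.r_unit ω) _ _) (congrArg H.unit (t.s_muX _ _ _).symm) _ _

theorem Unital.gmul_unit_left {t : ActorData C H} (ht : t.Unital) (h : H.Arr) :
    t.gmul (G.unit (t.rho (H.r h))) h (G.s_unit _) = h := by
  refine (t.gmul_congr rfl (H.unit_mul h).symm _
    ((G.s_unit _).trans (congrArg t.rho ((H.r_mul _ _ _).trans (H.r_unit _)).symm))).trans ?_
  rw [← t.gmul_mul _ (H.unit (H.r h)) h ((G.s_unit _).trans (congrArg t.rho (H.r_unit _).symm))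
    (H.s_unit _)]
  exact (H.mul_congr (ht (H.r h)) rfl _ (H.s_unit _)).trans (H.unit_mul h)

/-- The left action of `G` on the arrow space of `H` defined by a triple. -/
def leftAction (h₁ : t.Associative) (h₂ : t.Unital) : LeftAction G H.Arr where
  anchor h := t.rho (H.r h)
  act := t.gmul
  continuous_anchor := t.continuous_rho.comp H.isLocalHomeomorph_r.continuous
  continuous_act := by
    have h : Continuous fun p : FibreProduct G.s fun h => t.rho (H.r h) =>
        (⟨(p.1.1, H.r p.1.2), p.2⟩ : FibreProduct G.s t.rho) :=
      Continuous.subtype_mk ((continuous_fst.comp continuous_subtype_val).prodMk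
        (H.isLocalHomeomorph_r.continuous.comp (continuous_snd.comp continuous_subtype_val))) _
    exact H.continuous_mul.comp (Continuous.subtype_mk ((t.continuous_muG.comp h).prodMk
      (continuous_snd.comp continuous_subtype_val)) fun p => t.s_muG p.1.1 (H.r p.1.2) p.2)
  anchor_act := t.rho_r_gmul
  act_act := h₁.1
  unit_act := h₂.gmul_unit_left

theorem continuous_xmul : Continuous fun p : FibreProduct C.right.anchor fun h => t.rho (H.r h) =>
    t.xmul p.1.1 p.1.2 p.2 := by
  have h : Continuous fun p : FibreProduct C.right.anchor fun h => t.rho (H.r h) =>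
      (⟨(p.1.1, H.r p.1.2), p.2⟩ : FibreProduct C.right.anchor t.rho) :=
    Continuous.subtype_mk ((continuous_fst.comp continuous_subtype_val).prodMk
      (H.isLocalHomeomorph_r.continuous.comp (continuous_snd.comp continuous_subtype_val))) _
  exact H.continuous_mul.comp (Continuous.subtype_mk ((t.continuous_muX.comp h).prodMk
    (continuous_snd.comp continuous_subtype_val)) fun p => t.s_muX p.1.1 (H.r p.1.2) p.2)

/-- Composed with the étale map `s`, the multiplication becomes `(x, h) ↦ s(h)`, which is open
because the second projection is a base change of `s : X → G⁰`. -/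
theorem isOpenMap_xmul : IsOpenMap fun p : FibreProduct C.right.anchor fun h => t.rho (H.r h) =>
    t.xmul p.1.1 p.1.2 p.2 := by
  refine H.isLocalHomeomorph_s.isOpenMap_of_comp t.continuous_xmul ?_
  have h : IsOpenMap fun p : FibreProduct C.right.anchor fun h => t.rho (H.r h) => p.1.2 :=
    FibreProduct.isOpenMap_snd C.etale.isOpenMap
      (t.continuous_rho.comp H.isLocalHomeomorph_r.continuous)
  simp only [s_xmul]
  exact H.isLocalHomeomorph_s.isOpenMap.comp h

/-- The `(G, X, R)`-action on the arrow space of `H` defined by a triple. -/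
def corrAction (h₁ : t.Associative) (h₂ : t.Unital) (h₃ : t.IdentifiesOrbits) (h₄ : t.Covers R)
    (h₅ : t.HasClosedImages) : CorrAction C R H.Arr where
  toLeftAction := t.leftAction h₁ h₂
  xact := t.xmul
  continuous_xact := t.continuous_xmul
  isOpenMap_xact := t.isOpenMap_xmul
  anchor_xact := t.rho_r_xmul
  act_xact := h₁.2.1
  xact_eq_iff x x' y y' p p' := by
    refine ⟨h₃ x x' y y' p p', ?_⟩
    rintro ⟨g, q, q', rfl, rfl⟩
    exact h₁.2.2 x g y' q q'
  covers y hy := by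
    obtain ⟨x, ω, p, e⟩ := h₄ hy
    have e' : H.s (H.inv (t.muX x ω p)) = H.r y := (H.s_inv _).trans e
    have e'' : H.r (H.mul (H.inv (t.muX x ω p)) y e') = ω := by
      rw [H.r_mul, H.r_inv, t.s_muX]
    -- The factorisation is `y = x · (μ_X(x, ω)⁻¹ y)`.
    refine ⟨x, H.mul (H.inv (t.muX x ω p)) y e', p.trans (congrArg t.rho e''.symm), ?_⟩
    exact (H.mul_congr (t.muX_congr rfl e'' _ p) rfl _ ((H.r_inv _).symm.trans
      (H.r_mul _ _ _).symm)).trans (H.mul_inv_mul _ y e)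
  closed K hK := by
    convert (h₅ K hK).preimage H.isLocalHomeomorph_r.continuous using 1
    ext z
    constructor
    · rintro ⟨x, h, p, hx, rfl⟩
      exact ⟨x, h, p, hx, rfl⟩
    · rintro ⟨x, h, p, hx, e⟩
      have e' : H.s (H.inv (t.xmul x h p)) = H.r z := (H.s_inv _).trans e
      have e'' : H.s h = H.r (H.mul (H.inv (t.xmul x h p)) z e') := by
        rw [H.r_mul, H.r_inv, t.s_xmul]
      -- From `r(x · h) = r(z)` one gets `z = x · (h (x · h)⁻¹ z)`, with the same `x`.
      refine ⟨x, H.mul h (H.mul (H.inv (t.xmul x h p)) z e') e'',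
        p.trans (congrArg t.rho (H.r_mul _ _ _).symm), hx, ?_⟩
      exact (t.xmul_mul x h _ p e'').symm.trans (H.mul_inv_mul _ z e)

theorem corrAction_isRightInvariant (h₁ : t.Associative) (h₂ : t.Unital)
    (h₃ : t.IdentifiesOrbits) (h₄ : t.Covers R) (h₅ : t.HasClosedImages) :
    (t.corrAction h₁ h₂ h₃ h₄ h₅).IsRightInvariant where
  s_act := t.s_gmul
  anchor_mul h k p := congrArg t.rho (H.r_mul h k p)
  act_mul := t.gmul_mul
  s_xact := t.s_xmul
  xact_mul := t.xmul_mul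

/-- The multiplication maps of a `(G, X, R)`-action on the arrow space of `H` are those defined by
a triple. -/
def DefinesAction (t : ActorData C H) (a : CorrAction C R H.Arr) : Prop :=
  ∃ e : ∀ h, a.anchor h = t.rho (H.r h),
    (∀ (g : G.Arr) (h : H.Arr) (p : G.s g = a.anchor h),
      a.act g h p = t.gmul g h (p.trans (e h))) ∧
    (∀ (x : C.carrier) (h : H.Arr) (p : C.right.anchor x = a.anchor h),
      a.xact x h p = t.xmul x h (p.trans (e h)))

namespace DefinesAction

variable {t} {a a' : CorrAction C R H.Arr}

theorem action_unique (h : t.DefinesAction a) (h' : t.DefinesAction a') : a = a' := by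
  obtain ⟨e, h1, h2⟩ := h
  obtain ⟨e', h1', h2'⟩ := h'
  exact CorrAction.ext_of_eq (fun y => (e y).trans (e' y).symm)
    (fun g y p => (h1 g y p).trans (h1' g y _).symm)
    (fun x y p => (h2 x y p).trans (h2' x y _).symm)

theorem anchor_unit (h : t.DefinesAction a) (ω : H.Obj) : a.anchor (H.unit ω) = t.rho ω :=
  (h.1 _).trans (congrArg t.rho (H.r_unit ω))

/-- The action recovers the triple at units: `μ_G(g, ω) = g · 1_ω` and `μ_X(x, ω) = x · 1_ω`. -/
theorem triple_unique {t' : ActorData C H} (h : t.DefinesAction a) (h' : t'.DefinesAction a) :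
    t = t' := by
  refine ext_of_eq (fun ω => (h.anchor_unit ω).symm.trans (h'.anchor_unit ω)) (fun g ω p => ?_)
    (fun x ω p => ?_)
  · have h1 := h.2.1 g (H.unit ω) (p.trans (h.anchor_unit ω).symm)
    have h2 := h'.2.1 g (H.unit ω) (p.trans (h.anchor_unit ω).symm)
    rw [gmul_unit] at h1 h2
    exact h1.symm.trans h2
  · have h1 := h.2.2 x (H.unit ω) (p.trans (h.anchor_unit ω).symm)
    have h2 := h'.2.2 x (H.unit ω) (p.trans (h.anchor_unit ω).symm)
    rw [xmul_unit] at h1 h2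
    exact h1.symm.trans h2

theorem associative (h : t.DefinesAction a) : t.Associative := by
  obtain ⟨e, h1, h2⟩ := h
  have hg : ∀ (g : G.Arr) (h : H.Arr) (p : G.s g = t.rho (H.r h)),
      t.gmul g h p = a.act g h (p.trans (e h).symm) := fun g h p => (h1 g h _).symm
  have hx : ∀ (x : C.carrier) (h : H.Arr) (p : C.right.anchor x = t.rho (H.r h)),
      t.xmul x h p = a.xact x h (p.trans (e h).symm) := fun x h p => (h2 x h _).symm
  refine ⟨fun g₁ g₂ h p q => ?_, fun g x h p q => ?_, fun x g h p q => ?_⟩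
  · refine (hg _ _ _).trans (Eq.trans ?_ (hg _ _ _).symm)
    rw [← a.act_act g₁ g₂ h p (q.trans (e h).symm)]
    exact a.act_congr rfl (hg _ _ _) _ _
  · refine (hg _ _ _).trans (Eq.trans ?_ (hx _ _ _).symm)
    rw [← a.act_xact g x h p (q.trans (e h).symm)]
    exact a.act_congr rfl (hx _ _ _) _ _
  · refine (hx _ _ _).trans (Eq.trans ?_ (hx _ _ _).symm)
    rw [← a.xact_act x g h p (q.trans (e h).symm)]
    exact a.xact_congr rfl (hg _ _ _) _ _

theorem unital (h : t.DefinesAction a) : t.Unital := by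
  obtain ⟨e, h1, -⟩ := h
  intro ω
  have e' : a.anchor (H.unit ω) = t.rho ω := (e _).trans (congrArg t.rho (H.r_unit ω))
  rw [← h1 _ (H.unit ω) ((G.s_unit _).trans e'.symm)]
  exact (a.act_congr (congrArg G.unit e'.symm) rfl _ (G.s_unit _)).trans (a.unit_act _)

theorem identifiesOrbits (h : t.DefinesAction a) : t.IdentifiesOrbits := by
  obtain ⟨e, h1, h2⟩ := h
  intro x₁ x₂ y₁ y₂ p₁ p₂ heq
  rw [← h2 x₁ y₁ (p₁.trans (e _).symm), ← h2 x₂ y₂ (p₂.trans (e _).symm)] at heq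
  obtain ⟨g, q, q', hx, hy⟩ := (a.xact_eq_iff _ _ _ _ _ _).1 heq
  exact ⟨g, q, q'.trans (e _), hx, hy.trans (h1 _ _ _)⟩

theorem covers (h : t.DefinesAction a) : t.Covers R := by
  intro ω hω
  have hω' : a.anchor (H.unit ω) ∈ R := by
    rw [h.anchor_unit]
    exact hω
  obtain ⟨e, -, h2⟩ := h
  obtain ⟨x, y, p, hxy⟩ := a.covers _ hω'
  refine ⟨x, H.r y, p.trans (e y), ?_⟩
  rw [← t.r_xmul, ← h2 x y p, hxy, H.r_unit]

theorem hasClosedImages (h : t.DefinesAction a) : t.HasClosedImages := by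
  obtain ⟨e, -, h2⟩ := h
  intro K hK
  convert (a.closed K hK).preimage H.continuous_unit using 1
  ext ω
  constructor
  · rintro ⟨x, h, p, hx, rfl⟩
    have q : H.s h = H.r (H.inv (t.xmul x h p)) := by
      rw [H.r_inv, t.s_xmul]
    -- Translating by `(x · h)⁻¹` on the right turns `x · h` into the unit at its range.
    refine ⟨x, H.mul h (H.inv (t.xmul x h p)) q,
      p.trans ((congrArg t.rho (H.r_mul _ _ _).symm).trans (e _).symm), hx, ?_⟩
    rw [h2, ← t.xmul_mul x h _ p q, H.mul_inv]
  · rintro ⟨x, h, p, hx, hxh⟩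
    refine ⟨x, h, p.trans (e h), hx, ?_⟩
    rw [← h2 x h p, hxh, H.r_unit]

end DefinesAction

theorem corrAction_definesAction (h₁ : t.Associative) (h₂ : t.Unital) (h₃ : t.IdentifiesOrbits)
    (h₄ : t.Covers R) (h₅ : t.HasClosedImages) :
    t.DefinesAction (t.corrAction h₁ h₂ h₃ h₄ h₅) :=
  ⟨fun _ => rfl, fun _ _ _ => rfl, fun _ _ _ => rfl⟩

/-- If `ϱ` is proper, then the condition on closed images follows from the associativity laws. -/
theorem Associative.hasClosedImages {t : ActorData C H} (h₁ : t.Associative) (h₂ : t.Unital)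
    (hrho : IsProperMap t.rho) : t.HasClosedImages := by
  intro K hK
  let E := FibreProduct C.right.anchor fun h => t.rho (H.r h)
  let q : E → C.carrier := fun e => e.1.1
  let m : E → H.Obj := fun e => H.r (t.xmul e.1.1 e.1.2 e.2)
  refine isClosed_of_closure_subset fun η hη => ?_
  obtain ⟨𝒰, h𝒰, hle⟩ := mem_closure_iff_ultrafilter.1 hη
  have hm : m '' {e | C.right.proj (q e) ∈ K} ∈ 𝒰 := by
    refine mem_of_superset h𝒰 ?_
    rintro _ ⟨x, h, p, hx, rfl⟩
    exact ⟨⟨(x, h), p⟩, hx, rfl⟩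
  have hmap := Ultrafilter.ofComapInfPrincipal_eq_of_map hm
  have hmem := Ultrafilter.ofComapInfPrincipal_mem hm
  set 𝒲 := Ultrafilter.ofComapInfPrincipal hm
  obtain ⟨k, hk, hlim⟩ := hK.ultrafilter_le_nhds' (𝒲.map fun e => C.right.proj (q e)) hmem
  induction k using Quotient.inductionOn with
  | h x₀ =>
    -- Replacing `(x, h)` by `(x · g, g⁻¹ · h)` leaves the product unchanged, so the first factors
    -- may be taken to converge to `x₀` in `X` and not merely in `X / G`.
    obtain ⟨𝒱, hq, hmap'⟩ := C.right.exists_ultrafilter_tendsto q m (by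
      rintro ⟨⟨x, h⟩, p⟩ x' hx'
      obtain ⟨g, hg, rfl⟩ := C.right.proj_eq_proj_iff.1 hx'.symm
      have p' : G.s (G.inv g) = t.rho (H.r h) := (G.s_inv g).trans (hg.symm.trans p)
      have p'' : G.s g = t.rho (H.r (t.gmul (G.inv g) h p')) := by
        rw [t.rho_r_gmul, G.r_inv]
      refine ⟨⟨(C.right.act x g hg, t.gmul (G.inv g) h p'),
        (C.right.anchor_act x g hg).trans p''⟩, rfl, congrArg H.r ?_⟩
      refine (h₁.2.2 x g _ hg p'').symm.trans ?_
      exact t.xmul_congr rfl ((t.leftAction h₁ h₂).act_inv_act g h (hg.symm.trans p)) _ p)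
      𝒲 x₀ hlim
    have hr : Tendsto t.rho (𝒱.map fun e : E => H.r e.1.2) (𝓝 (C.right.anchor x₀)) := by
      refine tendsto_map'_iff.2 (((C.right.continuous_anchor.tendsto x₀).comp hq).congr ?_)
      exact fun e => e.2
    -- The ranges `r(h)` now converge to some `ω` by properness of `ϱ`; continuity of `μ_X` and the
    -- Hausdorff property of `H⁰` identify `η` with `r(μ_X(x₀, ω))`.
    obtain ⟨ω, hω, hle'⟩ := hrho.ultrafilter_le_nhds_of_tendsto hr
    have hmu := (t.continuous_muX.tendsto ⟨(x₀, ω), hω.symm⟩).comp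
      (FibreProduct.tendsto_mk (fun e : E => e.2) hω.symm hq hle')
    have hη₁ : Tendsto m 𝒱 (𝓝 (H.r (t.muX x₀ ω hω.symm))) :=
      ((H.isLocalHomeomorph_r.continuous.tendsto _).comp hmu).congr fun e =>
        (t.r_xmul _ _ _).symm
    have hη₂ : Tendsto m 𝒱 (𝓝 η) := by
      have h := congrArg Ultrafilter.toFilter (hmap'.trans hmap)
      exact le_trans (le_of_eq h) hle
    refine ⟨x₀, H.unit ω, hω.symm.trans (congrArg t.rho (H.r_unit ω).symm), hk, ?_⟩
    rw [xmul_unit]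
    exact tendsto_nhds_unique hη₁ hη₂

end ActorData

/-! ### From right invariant actions back to triples. -/

namespace CorrAction.IsRightInvariant

variable {G H : EtaleGroupoid.{u}} {C : Correspondence G G} {R : Set G.Obj}
  {a : CorrAction C R H.Arr}

theorem anchor_unit_r (ha : a.IsRightInvariant) (h : H.Arr) :
    a.anchor (H.unit (H.r h)) = a.anchor h := by
  rw [← ha.anchor_mul (H.unit (H.r h)) h (H.s_unit _), H.unit_mul]

/-- The triple defined by a `(G, X, R)`-action that commutes with right translations. -/
def actorData (ha : a.IsRightInvariant) : ActorData C H where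
  rho ω := a.anchor (H.unit ω)
  muG g ω p := a.act g (H.unit ω) p
  muX x ω p := a.xact x (H.unit ω) p
  continuous_rho := a.continuous_anchor.comp H.continuous_unit
  continuous_muG := a.continuous_act.comp (Continuous.subtype_mk
    ((continuous_fst.comp continuous_subtype_val).prodMk
      (H.continuous_unit.comp (continuous_snd.comp continuous_subtype_val))) fun p => p.2)
  continuous_muX := a.continuous_xact.comp (Continuous.subtype_mk
    ((continuous_fst.comp continuous_subtype_val).prodMk
      (H.continuous_unit.comp (continuous_snd.comp continuous_subtype_val))) fun p => p.2)
  isOpenMap_muX := by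
    refine H.isLocalHomeomorph_s.isOpenMap_of_comp
      (a.continuous_xact.comp (Continuous.subtype_mk
        ((continuous_fst.comp continuous_subtype_val).prodMk
          (H.continuous_unit.comp (continuous_snd.comp continuous_subtype_val))) fun p => p.2)) ?_
    have h : IsOpenMap fun p : FibreProduct C.right.anchor fun ω => a.anchor (H.unit ω) => p.1.2 :=
      FibreProduct.isOpenMap_snd C.etale.isOpenMap (a.continuous_anchor.comp H.continuous_unit)
    simpa only [Function.comp_apply, ha.s_xact, H.s_unit] using h
  s_muG g ω p := (ha.s_act _ _ _).trans (H.s_unit ω)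
  s_muX x ω p := (ha.s_xact _ _ _).trans (H.s_unit ω)
  rho_r_muG g ω p := (ha.anchor_unit_r _).trans (a.anchor_act _ _ _)
  rho_r_muX x ω p := (ha.anchor_unit_r _).trans (a.anchor_xact _ _ _)

theorem actorData_definesAction (ha : a.IsRightInvariant) : ha.actorData.DefinesAction a := by
  refine ⟨fun h => (ha.anchor_unit_r h).symm, fun g h p => ?_, fun x h p => ?_⟩
  · refine Eq.trans ?_ (ha.act_mul g (H.unit (H.r h)) h (p.trans (ha.anchor_unit_r h).symm)
      (H.s_unit _)).symm
    exact a.act_congr rfl (H.unit_mul h).symm _ _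
  · refine Eq.trans ?_ (ha.xact_mul x (H.unit (H.r h)) h (p.trans (ha.anchor_unit_r h).symm)
      (H.s_unit _)).symm
    exact a.xact_congr rfl (H.unit_mul h).symm _ _

end CorrAction.IsRightInvariant

/-! ### Actors of the groupoid model and the main theorem. -/

namespace GroupoidModel

variable {G H : EtaleGroupoid.{u}} {C : Correspondence G G} {R : Set G.Obj}
  (𝓜 : GroupoidModel C R)

theorem isRightInvariant_symm (A : Actor 𝓜.M H) :
    ((𝓜.equiv H.Arr).symm A.toLeftAction).IsRightInvariant := by
  rw [𝓜.isRightInvariant_iff, Equiv.apply_symm_apply]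
  exact A.isRightInvariant

/-- The actor given by a `(G, X, R)`-action that commutes with right translations. -/
def actor (a : CorrAction C R H.Arr) (ha : a.IsRightInvariant) : Actor 𝓜.M H where
  toLeftAction := 𝓜.equiv H.Arr a
  s_act := ((𝓜.isRightInvariant_iff a).1 ha).s_act
  anchor_mul := ((𝓜.isRightInvariant_iff a).1 ha).anchor_mul
  act_mul := ((𝓜.isRightInvariant_iff a).1 ha).act_mul

/-- This factorisation of `ϱ` through `M⁰` reduces properness of the actor to properness of `ϱ`. -/
theorem objCorrAction_anchor_comp_objMap {t : ActorData C H} {A : Actor 𝓜.M H}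
    (h : t.Defines 𝓜 A) : 𝓜.objCorrAction.anchor ∘ A.objMap = t.rho := by
  funext ω
  have h1 := 𝓜.objCorrAction_anchor ((𝓜.equiv H.Arr).symm A.toLeftAction) (H.unit ω)
  rw [Equiv.apply_symm_apply] at h1
  exact h1.trans (ActorData.DefinesAction.anchor_unit h ω)

end GroupoidModel

theorem mainTheorem3 (G H : EtaleGroupoid.{u}) (R : Set G.Obj) (hR : IsOpen R)
    (hRinv : G.IsInvariant R) (C : Correspondence G G) (hC : C.IsRegularOn R)
    (𝓜 : GroupoidModel C R) :
    -- a triple defines an actor if and only if it satisfies the five conditions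
    (∀ t : ActorData C H, (∃ A : Actor 𝓜.M H, t.Defines 𝓜 A) ↔
      t.Associative ∧ t.Unital ∧ t.IdentifiesOrbits ∧ t.Covers R ∧ t.HasClosedImages) ∧
    -- the actor defined by a triple is unique
    (∀ (t : ActorData C H) (A A' : Actor 𝓜.M H), t.Defines 𝓜 A → t.Defines 𝓜 A' → A = A') ∧
    -- every actor is defined by a unique triple
    (∀ A : Actor 𝓜.M H, ∃! t : ActorData C H, t.Defines 𝓜 A) ∧
    -- the actor is proper if and only if the first map of the triple is proper
    (∀ (t : ActorData C H) (A : Actor 𝓜.M H), t.Defines 𝓜 A →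
      (A.IsProper ↔ IsProperMap t.rho)) ∧
    -- in that case the closedness condition is redundant
    (∀ t : ActorData C H, IsProperMap t.rho →
      t.Associative → t.Unital → t.IdentifiesOrbits → t.Covers R → t.HasClosedImages) := by
  refine ⟨fun t => ⟨?_, ?_⟩, fun t A A' h h' => ?_, fun A => ?_, fun t A h => ?_,
    fun t hrho h₁ h₂ _ _ => h₁.hasClosedImages h₂ hrho⟩
  · rintro ⟨A, h⟩
    have h' : t.DefinesAction _ := h
    exact ⟨h'.associative, h'.unital, h'.identifiesOrbits, h'.covers, h'.hasClosedImages⟩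
  · rintro ⟨h₁, h₂, h₃, h₄, h₅⟩
    refine ⟨𝓜.actor _ (t.corrAction_isRightInvariant h₁ h₂ h₃ h₄ h₅), ?_⟩
    change t.DefinesAction ((𝓜.equiv H.Arr).symm (𝓜.equiv H.Arr _))
    rw [Equiv.symm_apply_apply]
    exact t.corrAction_definesAction h₁ h₂ h₃ h₄ h₅
  · exact Actor.ext_toLeftAction ((𝓜.equiv H.Arr).symm.injective
      (ActorData.DefinesAction.action_unique h h'))
  · have ha := 𝓜.isRightInvariant_symm A
    exact ⟨ha.actorData, ha.actorData_definesAction, fun t h =>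
      ActorData.DefinesAction.triple_unique h ha.actorData_definesAction⟩
  · have hc := 𝓜.objCorrAction_anchor_comp_objMap h
    have hA : Continuous A.objMap := A.continuous_anchor.comp H.continuous_unit
    constructor
    · intro hp
      rw [← hc]
      exact (𝓜.isProperMap_objCorrAction_anchor hR hC).comp hp
    · intro hp
      rw [← hc] at hp
      -- A continuous first factor of a proper composite is proper when the middle space, here `M⁰`,
      -- is Hausdorff.
      exact isProperMap_of_comp_of_t2 hA 𝓜.objCorrAction.continuous_anchor hp
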